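/- Let $G$ be a diffeological group which is a Lie group modelled on a convenient vector space $E$, i.e. a $D$-open neighbourhood of $1\in G$ is diffeomorphic to a $D$-open subset of $E$ (finite-dimensional, Banach, Fréchet–Lie groups, loop groups and current groups are examples). Let $\sigma:\mathbb Z_2\to\operatorname{Aut}(G)$ be an action by smooth automorphisms, $H_\sigma=G\rtimes_\sigma\mathbb Z_2$ with $\mathbb Z_2$ discrete, and $\mathfrak h_\sigma=\operatorname{Lie}(H_\sigma)=\operatorname{Lie}(G)\cong E$. Let $\pi:Q\to X$ be a diffeological principal $H_\sigma$-bundle (right action) over a diffeological space $X$. Differential forms on diffeological spaces are defined plotwise. Let $P$ be a symmetric smooth $r$-linear form on $\mathfrak h_\sigma$, invariant under the adjoint action of $H_\sigma$. Consider any locally finite $D$-open cover $(U_i)_{i\in I}$ of $X$ with smooth local sections $s_i:U_i\to Q$ and a smooth partition of unity $(\lambda_i)$ subordinate to it (in particular $\operatorname{supp}\lambda_i\subset U_i$). Define the transition functions $h_{ki}:U_k\cap U_i\to H_\sigma$ by $s_k=s_i\,h_{ki}$, and put $$A_k=\sum_i\lambda_i\,h_{ki}^{-1}dh_{ki},\qquad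 F_k=dA_k+\tfrac12[A_k,A_k]\qquad\text{on }U_k .$$ 1. There is a principal connection form $\Theta$ on $Q$ (the barycentric connection) with $s_k^*\Theta=A_k$ for all $k$. 2. There is a unique differential form $\eta$ of degree $2r$ on $X$ with $\eta|_{U_k}=P(F_k,\dots,F_k)$ for all $k$, and $d\eta=0$. 3. More generally, for every principal connection form $\Theta$ on $Q$ and every $D$-open cover $(U_k)$ of $X$ with smooth local sections $s_k$ of $Q$, set $A_k=s_k^*\Theta$ and $F_k=dA_k+\frac12[A_k,A_k]$. Then there is a unique differential form $\eta$ of degree $2r$ on $X$ with $\eta|_{U_k}=P(F_k,\dots,F_k)$ for all $k$, and $d\eta=0$. 4. The de Rham class $[\eta]\in H^{2r}_{\mathrm{dR}}(X)$ is the same for all the choices in 2 and 3: it depends neither on the cover, the local sections and the partition of unity, nor on the connection. -/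

import Mathlib

open Diffeology ContDiff Topology

namespace BaryChernWeil

/-- Parameter domains of plots. -/
abbrev Euc (m : ℕ) : Type := EuclideanSpace ℝ (Fin m)

section Diffeologies

/-- Smoothness of a map on a (D-open) subset `U`, for the subset diffeology: plots with values in
`U` are sent to plots. -/
def SmoothOn {X Y : Type*} [DiffeologicalSpace X] [DiffeologicalSpace Y]
    (f : X → Y) (U : Set X) : Prop :=
  ∀ (m : ℕ) (p : Euc m → X), IsPlot p → (∀ x, p x ∈ U) → IsPlot (f ∘ p)

/-- Diffeological groups: multiplication and inversion are smooth. -/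
class DiffeologicalGroup (H : Type*) [Group H] [DiffeologicalSpace H] : Prop where
  mul_plot : ∀ {m : ℕ} {p q : Euc m → H}, IsPlot p → IsPlot q → IsPlot (fun x => p x * q x)
  inv_plot : ∀ {m : ℕ} {p : Euc m → H}, IsPlot p → IsPlot (fun x => (p x)⁻¹)

/-- The group of two elements `ℤˣ = {1, -1}` being discrete, `G ⋊[σ] ℤˣ` carries the product
diffeology: the `G`-component of a plot is a plot, its sign component is locally constant. -/
instance semidirectDiffeology {G : Type*} [Group G] [DiffeologicalSpace G]
    (σ : ℤˣ →* MulAut G) : DiffeologicalSpace (G ⋊[σ] ℤˣ) where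
  plots m := {p | IsPlot (fun x : Euc m => (p x).left) ∧ IsLocallyConstant fun x => (p x).right}
  constant_plots h := ⟨isPlot_const, IsLocallyConstant.const _⟩
  plot_reparam {n m p f} hp hf :=
    ⟨isPlot_reparam (p := fun x => (p x).left) hp.1 hf, hp.2.comp_continuous hf.continuous⟩
  locality {n p} hp := by
    refine ⟨DiffeologicalSpace.locality fun x => ?_, ?_⟩
    · obtain ⟨u, hu, hxu, h⟩ := hp x
      exact ⟨u, hu, hxu, fun hf hf' => (h hf hf').1⟩
    · rw [IsLocallyConstant.iff_exists_open]
      intro x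
      obtain ⟨u, hu, hxu, h⟩ := hp x
      obtain ⟨ε, hε, hε'⟩ := Metric.isOpen_iff.mp hu x hxu
      let e : OpenPartialHomeomorph (Euc n) (Euc n) := OpenPartialHomeomorph.univBall x ε
      have ht : e.target = Metric.ball x ε := OpenPartialHomeomorph.univBall_target x hε
      have hs : e.source = Set.univ := OpenPartialHomeomorph.univBall_source x ε
      have hmem : ∀ y, e y ∈ u := fun y => hε' (by
        rw [← ht]; exact e.map_source (by rw [hs]; trivial))
      have hc := (h (f := e) hmem OpenPartialHomeomorph.contDiff_univBall).2
      refine ⟨Metric.ball x ε, Metric.isOpen_ball, Metric.mem_ball_self hε, fun y hy => ?_⟩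
      have key := hc.apply_eq_of_isPreconnected (isPreconnected_univ)
        (Set.mem_univ (e.symm y)) (Set.mem_univ (e.symm x))
      simpa [Function.comp, e.right_inv (ht ▸ hy),
        e.right_inv (ht ▸ Metric.mem_ball_self hε : x ∈ e.target)] using key

end Diffeologies

section Calculus

/-- Convenient vector spaces: real vector spaces with a diffeology such that
smooth linear functionals separate points and detect plots, and scalarwise smooth curves have
derivatives. All finite-dimensional, Banach and Fréchet spaces are of this kind. -/
class ConvenientSpace (E : Type*) [AddCommGroup E] [Module ℝ E] [DiffeologicalSpace E] :
    Prop where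
  separated : ∀ v : E, v ≠ 0 → ∃ ℓ : E →ₗ[ℝ] ℝ, DSmooth ℓ ∧ ℓ v ≠ 0
  plot_of_scalarwise : ∀ {m : ℕ} (p : Euc m → E),
    (∀ ℓ : E →ₗ[ℝ] ℝ, DSmooth ℓ → ContDiff ℝ ∞ fun x => ℓ (p x)) → IsPlot p
  exists_deriv : ∀ c : ℝ → E,
    (∀ ℓ : E →ₗ[ℝ] ℝ, DSmooth ℓ → ContDiff ℝ ∞ fun t => ℓ (c t)) →
    ∃ v : E, ∀ ℓ : E →ₗ[ℝ] ℝ, DSmooth ℓ → HasDerivAt (fun t => ℓ (c t)) (ℓ v) 0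

open Classical in
/-- The derivative at `0` of a curve in a convenient vector space (`0` if there is none). -/
noncomputable def curveDeriv {E : Type*} [AddCommGroup E] [Module ℝ E] [DiffeologicalSpace E]
    (c : ℝ → E) : E :=
  if h : ∃ v : E, ∀ ℓ : E →ₗ[ℝ] ℝ, DSmooth ℓ → HasDerivAt (fun t => ℓ (c t)) (ℓ v) 0
  then h.choose else 0

end Calculus

section LieGroups

variable {H E : Type*} [Group H] [DiffeologicalSpace H]
  [AddCommGroup E] [Module ℝ E] [DiffeologicalSpace E]

/-- A chart at the identity: a diffeomorphism from a D-open neighbourhood of `1` in `H` onto a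
D-open subset of `E`. A diffeological group with such a chart, `E` convenient, is a Lie group
modelled on `E`; its Lie algebra `T₁H` is identified with `E` by the differential of the chart. -/
structure LieChart (H E : Type*) [Group H] [DiffeologicalSpace H]
    [AddCommGroup E] [Module ℝ E] [DiffeologicalSpace E] extends PartialEquiv H E where
  open_source : IsOpen[dTopology] source
  open_target : IsOpen[dTopology] target
  one_mem : (1 : H) ∈ source
  smooth_toFun : SmoothOn toFun source
  smooth_invFun : SmoothOn invFun target

/-- The chart of `G ⋊[σ] ℤˣ` given by a chart of its open subgroup `G`; in particular both
groups have the same Lie algebra. -/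
def LieChart.semidirect {G : Type*} [Group G] [DiffeologicalSpace G] (φ : LieChart G E)
    (σ : ℤˣ →* MulAut G) : LieChart (G ⋊[σ] ℤˣ) E where
  toFun h := φ.toFun h.left
  invFun v := ⟨φ.invFun v, 1⟩
  source := {h | h.left ∈ φ.source ∧ h.right = 1}
  target := φ.target
  map_source' h hh := φ.map_source' hh.1
  map_target' v hv := ⟨φ.map_target' hv, rfl⟩
  left_inv' h hh := SemidirectProduct.ext (φ.left_inv' hh.1) hh.2.symm
  right_inv' v hv := φ.right_inv' hv
  open_source := by
    rw [isOpen_iff_preimages_plots]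
    intro n p hp
    exact (isOpen_iff_preimages_plots.1 φ.open_source n _ hp.1).inter (hp.2.isOpen_fiber 1)
  open_target := φ.open_target
  one_mem := ⟨φ.one_mem, rfl⟩
  smooth_toFun m p hp hU := φ.smooth_toFun m (fun x => (p x).left) hp.1 fun x => (hU x).1
  smooth_invFun m p hp hU := ⟨φ.smooth_invFun m p hp hU, IsLocallyConstant.const _⟩

namespace LieChart

variable (φ : LieChart H E)

/-- The curve in `H` through `1` with initial velocity `ξ` that is straight in the chart. -/
def curve (ξ : E) (t : ℝ) : H := φ.invFun (φ.toFun 1 + t • ξ)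

/-- The adjoint action: the velocity at `1` of `t ↦ h c(t) h⁻¹`, where `c` is a curve through `1`
with velocity `ξ`. -/
noncomputable def Ad (h : H) (ξ : E) : E :=
  curveDeriv fun t => φ.toFun (h * φ.curve ξ t * h⁻¹)

/-- The Lie bracket: the derivative of the adjoint action. -/
noncomputable def bracket (ξ η : E) : E := curveDeriv fun t => φ.Ad (φ.curve ξ t) η

/-- `h⁻¹dh`, i.e. the pull-back by `h` of the left Maurer-Cartan form, evaluated at the
vector `v` based at `x`. Only the values of `h` near `x` matter. -/
noncomputable def logDeriv {m : ℕ} (h : Euc m → H) (x v : Euc m) : E :=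
  curveDeriv fun t => φ.toFun ((h x)⁻¹ * h (x + t • v))

/-- The curvature `F = dA + ½[A,A]` of a Lie algebra valued `1`-form `A` on `Euc m`:
`F(v,w) = ∂_v A(w) - ∂_w A(v) + [A(v),A(w)]`, since `½[A,A](v,w) = [A(v),A(w)]`. -/
noncomputable def curvature {m : ℕ} (A : Euc m → Euc m → E) (x v w : Euc m) : E :=
  curveDeriv (fun t : ℝ => A (x + t • v) w) - curveDeriv (fun t : ℝ => A (x + t • w) v)
    + φ.bracket (A x v) (A x w)

/-- Invariant polynomials, homogeneous of degree `r`, on the Lie algebra: symmetric, smooth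
`r`-linear forms which are invariant under the adjoint action of `H`. -/
structure IsInvariantPolynomial {r : ℕ} (P : MultilinearMap ℝ (fun _ : Fin r => E) ℝ) :
    Prop where
  symm : ∀ (τ : Equiv.Perm (Fin r)) (v : Fin r → E), P (fun j => v (τ j)) = P v
  smooth : ∀ {m : ℕ} (f : Fin r → Euc m → E), (∀ j, IsPlot (f j)) →
    ContDiff ℝ ∞ fun x => P fun j => f j x
  invariant : ∀ (h : H) (v : Fin r → E), P (fun j => φ.Ad h (v j)) = P v

end LieChart

/-- `P(F,…,F)` for a Lie algebra valued `2`-form `F`, evaluated at `2r` vectors; the products are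
wedge products, `(α ∧ β)(v) = 1/(a! b!) ∑_τ sgn(τ) α(v_τ) β(v_τ)` in degrees `a` and `b`. -/
noncomputable def polyForm {V : Type*} {r : ℕ} (P : MultilinearMap ℝ (fun _ : Fin r => E) ℝ)
    (F : V → V → E) (v : Fin (2 * r) → V) : ℝ :=
  (1 / 2 : ℝ) ^ r * ∑ τ : Equiv.Perm (Fin (2 * r)), ((Equiv.Perm.sign τ : ℤ) : ℝ) *
    P fun j : Fin r => F (v (τ ⟨2 * (j : ℕ), by omega⟩)) (v (τ ⟨2 * (j : ℕ) + 1, by omega⟩))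

end LieGroups

section Forms

/-- Plots of `X` with domain `Euc m`. -/
abbrev Plot (X : Type*) [DiffeologicalSpace X] (m : ℕ) : Type _ := {p : Euc m → X // IsPlot p}

/-- Differential `n`-forms on a diffeological space: a smooth `n`-form for each plot, compatible
with smooth reparametrisations. -/
def dFormSubmodule (X : Type*) [DiffeologicalSpace X] (n : ℕ) :
    Submodule ℝ ((m : ℕ) → Plot X m → Euc m → Euc m [⋀^Fin n]→L[ℝ] ℝ) where
  carrier := {α | (∀ m p, ContDiff ℝ ∞ (α m p)) ∧
    ∀ (m k : ℕ) (p : Plot X m) (f : Euc k → Euc m) (hf : ContDiff ℝ ∞ f),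
      α k ⟨p.1 ∘ f, isPlot_reparam p.2 hf⟩ =
        fun x => (α m p (f x)).compContinuousLinearMap (fderiv ℝ f x)}
  add_mem' {a b} ha hb := by
    refine ⟨fun m p => (ha.1 m p).add (hb.1 m p), fun m k p f hf => ?_⟩
    funext x
    ext v
    simp [ha.2 m k p f hf, hb.2 m k p f hf]
  zero_mem' := by
    refine ⟨fun m p => contDiff_const, fun m k p f hf => ?_⟩
    funext x
    ext v
    simp
  smul_mem' c a ha := by
    refine ⟨fun m p => (ha.1 m p).const_smul c, fun m k p f hf => ?_⟩
    funext x
    ext v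
    simp [ha.2 m k p f hf]

/-- The type of differential `n`-forms on a diffeological space, a real vector space. -/
def DForm (X : Type*) [DiffeologicalSpace X] (n : ℕ) : Type _ := dFormSubmodule X n

noncomputable instance (X : Type*) [DiffeologicalSpace X] (n : ℕ) : AddCommGroup (DForm X n) :=
  inferInstanceAs (AddCommGroup (dFormSubmodule X n))

noncomputable instance (X : Type*) [DiffeologicalSpace X] (n : ℕ) : Module ℝ (DForm X n) :=
  inferInstanceAs (Module ℝ (dFormSubmodule X n))

variable (X : Type*) [DiffeologicalSpace X]

theorem DForm.differentiable {X : Type*} [DiffeologicalSpace X] {n : ℕ} (α : DForm X n)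
    (m : ℕ) (p : Plot X m) : Differentiable ℝ (α.1 m p) :=
  (α.2.1 m p).differentiable (by simp)

/-- The exterior derivative, computed in plots. -/
noncomputable def extD (n : ℕ) : DForm X n →ₗ[ℝ] DForm X (n + 1) where
  toFun α := ⟨fun m p => extDeriv (α.1 m p), by
    constructor
    · intro m p
      have h : ContDiff ℝ ∞ (fderiv ℝ (α.1 m p)) := (α.2.1 m p).fderiv_right (by simp)
      exact (ContinuousAlternatingMap.alternatizeUncurryFinCLM ℝ (Euc m) ℝ).contDiff.comp h
    · intro m k p f hf
      funext x
      change extDeriv (α.1 k ⟨p.1 ∘ f, isPlot_reparam p.2 hf⟩) x = _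
      rw [α.2.2 m k p f hf]
      exact extDeriv_pullback (r := ∞) (DForm.differentiable α m p _) hf.contDiffAt
        (by
          rw [minSmoothness_of_isRCLikeNormedField]
          exact WithTop.coe_le_coe.2 (le_top (a := (2 : ℕ∞))))⟩
  map_add' a b := Subtype.ext <| funext fun m => funext fun p => funext fun x =>
    extDeriv_add (DForm.differentiable a m p x) (DForm.differentiable b m p x)
  map_smul' c a := Subtype.ext <| funext fun m => funext fun p => funext fun x =>
    extDeriv_smul c _

/-- Closed forms. -/
noncomputable def closedForms (n : ℕ) : Submodule ℝ (DForm X n) := LinearMap.ker (extD X n)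

/-- Exact forms; only `0` is exact in degree `0`. -/
noncomputable def exactForms : (n : ℕ) → Submodule ℝ (DForm X n)
  | 0 => ⊥
  | n + 1 => LinearMap.range (extD X n)

/-- De Rham cohomology: closed forms modulo exact forms. -/
abbrev DeRham (n : ℕ) : Type _ :=
  closedForms X n ⧸ (exactForms X n).comap (closedForms X n).subtype

/-- The de Rham class of a closed form. -/
noncomputable def deRhamClass {X : Type*} [DiffeologicalSpace X] {n : ℕ} (η : closedForms X n) :
    DeRham X n :=
  Submodule.Quotient.mk η

end Forms

section Bundles

open MulOpposite

variable {X Q : Type*} [DiffeologicalSpace X] [DiffeologicalSpace Q]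

/-- Diffeological principal bundles, for a right action of `H` on the total space `Q`: the action
is smooth, free, transitive on the fibres of the smooth projection `π`, the map
`(q, h) ↦ (q, qh)` has smooth inverse on `Q ×_X Q`, and plots of the base lift locally. -/
structure IsPrincipalBundle (H : Type*) [Group H] [DiffeologicalSpace H]
    [MulAction Hᵐᵒᵖ Q] (π : Q → X) : Prop where
  smooth_proj : DSmooth π
  smooth_act : ∀ {m : ℕ} {q : Euc m → Q} {h : Euc m → H}, IsPlot q → IsPlot h →
    IsPlot fun x => op (h x) • q x
  fibre : ∀ q q' : Q, π q = π q' ↔ ∃ h : H, q' = op h • q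
  free : ∀ (q : Q) (h : H), op h • q = q → h = 1
  smooth_div : ∀ {m : ℕ} {q : Euc m → Q} {h : Euc m → H}, IsPlot q →
    IsPlot (fun x => op (h x) • q x) → IsPlot h
  lift : ∀ {m : ℕ} (p : Euc m → X), IsPlot p → ∀ x, ∃ q : Euc m → Q, IsPlot q ∧
    ∀ᶠ y in 𝓝 x, π (q y) = p y

/-- A family of local sections over a D-open cover (equivalently, of local trivialisations). -/
structure LocalSections (π : Q → X) (ι : Type*) where
  U : ι → Set X
  sec : ι → X → Q
  isOpen_U : ∀ i, IsOpen[dTopology] (U i)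
  cover : ∀ x, ∃ i, x ∈ U i
  smooth_sec : ∀ i, SmoothOn (sec i) (U i)
  proj_sec : ∀ i, ∀ x ∈ U i, π (sec i x) = x

/-- The data of a D-numerable bundle: local sections over a locally finite D-open cover, and a
smooth partition of unity subordinate to it. -/
structure NumerableSections (π : Q → X) (ι : Type*) extends LocalSections π ι where
  locallyFinite : @LocallyFinite ι X dTopology U
  lam : ι → X → ℝ
  smooth_lam : ∀ i, DSmooth (lam i)
  lam_nonneg : ∀ i x, 0 ≤ lam i x
  lam_sum : ∀ x, ∑ᶠ i, lam i x = 1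
  lam_supp : ∀ i, @closure X dTopology (Function.support (lam i)) ⊆ U i

section

variable {H E : Type*} [Group H] [DiffeologicalSpace H] [MulAction Hᵐᵒᵖ Q]
  [AddCommGroup E] [Module ℝ E] [DiffeologicalSpace E]

/-- The element `h` with `q' = qh`, for `q`, `q'` in the same fibre. -/
noncomputable def transition (H : Type*) [Group H] [MulAction Hᵐᵒᵖ Q] (q q' : Q) : H :=
  Classical.epsilon fun h => q' = op h • q

/-- The barycentric local form `A_k = ∑_i λ_i h_ki⁻¹dh_ki` on `U_k`, in the plot `p`, where the
transition function `h_ki` is given by `s_k = s_i h_ki` on `U_k ∩ U_i`. The terms with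
`λ_i = 0` vanish, in particular those at points outside `U_i`. -/
noncomputable def baryForm (φ : LieChart H E) {π : Q → X} {ι : Type*}
    (T : NumerableSections π ι) (k : ι) {m : ℕ} (p : Euc m → X) (x v : Euc m) : E :=
  ∑ᶠ i, T.lam i (p x) •
    φ.logDeriv (fun y => transition H (T.sec i (p y)) (T.sec k (p y))) x v

/-- Principal connection forms on `Q`: Lie algebra valued smooth `1`-forms on `Q` with
`(qh)^*Θ = Ad(h⁻¹) q^*Θ + h⁻¹dh`. For constant `h` this is equivariance, for constant `q` it says
that `Θ` restricts to the Maurer-Cartan form on the orbits. -/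
structure Connection (φ : LieChart H E) (Q : Type*) [DiffeologicalSpace Q]
    [MulAction Hᵐᵒᵖ Q] where
  form : (m : ℕ) → Plot Q m → Euc m → Euc m → E
  linear : ∀ m q x, IsLinearMap ℝ (form m q x)
  smooth : ∀ m q v, IsPlot fun x => form m q x v
  pullback : ∀ (m k : ℕ) (q : Plot Q m) (f : Euc k → Euc m) (hf : ContDiff ℝ ∞ f)
    (x v : Euc k), form k ⟨q.1 ∘ f, isPlot_reparam q.2 hf⟩ x v = form m q (f x) (fderiv ℝ f x v)
  gauge : ∀ (m : ℕ) (q : Plot Q m) (h : Euc m → H), IsPlot h →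
    ∀ (hq : IsPlot fun y => op (h y) • q.1 y) (x v : Euc m),
      form m ⟨fun y => op (h y) • q.1 y, hq⟩ x v =
        φ.Ad (h x)⁻¹ (form m q x v) + φ.logDeriv h x v

/-- The local form `A_k = s_k^*Θ` on `U_k`, in a plot `p` of `U_k`. -/
def Connection.localForm {φ : LieChart H E} (Θ : Connection φ Q) {π : Q → X} {ι : Type*}
    (S : LocalSections π ι) (k : ι) {m : ℕ} (p : Euc m → X) (hp : IsPlot p)
    (hU : ∀ x, p x ∈ S.U k) : Euc m → Euc m → E :=
  Θ.form m ⟨S.sec k ∘ p, S.smooth_sec k m p hp hU⟩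

/-- The global form `η` restricts on each `U_k` to `P(F_k,…,F_k)`, where `F_k = dA_k + ½[A_k,A_k]`,
for the local forms `A_k` of the connection `Θ`. -/
def GluesConnection (φ : LieChart H E) {r : ℕ} (P : MultilinearMap ℝ (fun _ : Fin r => E) ℝ)
    {π : Q → X} {ι : Type*} (S : LocalSections π ι) (Θ : Connection φ Q)
    (η : DForm X (2 * r)) : Prop :=
  ∀ (k : ι) (m : ℕ) (p : Euc m → X) (hp : IsPlot p) (hU : ∀ x, p x ∈ S.U k) (x : Euc m)
    (v : Fin (2 * r) → Euc m),
    η.1 m ⟨p, hp⟩ x v = polyForm P (φ.curvature (Θ.localForm S k p hp hU) x) v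

/-- The global form `η` restricts on each `U_k` to `P(F_k,…,F_k)`, where `F_k = dA_k + ½[A_k,A_k]`,
for the barycentric local forms `A_k`. -/
def GluesBary (φ : LieChart H E) {r : ℕ} (P : MultilinearMap ℝ (fun _ : Fin r => E) ℝ)
    {π : Q → X} {ι : Type*} (T : NumerableSections π ι) (η : DForm X (2 * r)) : Prop :=
  ∀ (k : ι) (m : ℕ) (p : Euc m → X) (hp : IsPlot p), (∀ x, p x ∈ T.U k) → ∀ (x : Euc m)
    (v : Fin (2 * r) → Euc m),
    η.1 m ⟨p, hp⟩ x v = polyForm P (φ.curvature (baryForm φ T k p) x) v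

end

end Bundles

end BaryChernWeil

/-!
Two lifts of a plot of `X` to `Q` differ by a smooth map `h` into the structure group. A gauge
transformation by `h` replaces the pulled-back form `A` by `Ad(h⁻¹)A + h⁻¹dh` and hence, by the
Maurer–Cartan equation, the curvature `F` by `Ad(h⁻¹)F`. Invariance of `P` therefore makes
`P(F,…,F)` independent of the lift, and it descends to a form on `X`.

For closedness at a point `x`, choose the lift so that `A` vanishes at `x`. The Bianchi identity
then says `dF = 0` at `x`, so differentiating `P(F,…,F)` as a product gives `0` there.

Two connections are the ends of the affine connection `(1 - t) Θ₀ + t Θ₁` on the principal bundle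
`Q × ℝ → X × ℝ`. Its Chern–Weil form is closed and restricts to the two given ones on the slices
`t = 0` and `t = 1`, whose difference is then the differential of its integral over the fibres
`[0, 1]`.

A partition of unity averages the flat connections of the local sections into a connection, because
the weights in the gauge condition add up to `1`. Its local forms are the barycentric ones.
-/

namespace BaryChernWeil

section ParametricIntegrals

theorem eventually_norm_le_of_continuous {Y Z F : Type*} [TopologicalSpace Y]
    [TopologicalSpace Z] [SeminormedAddCommGroup F] {f : Y × Z → F} (hf : Continuous f)
    {K : Set Z} (hK : IsCompact K) (x : Y) :
    ∃ C, ∀ᶠ y in 𝓝 x, ∀ t ∈ K, ‖f (y, t)‖ ≤ C := by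
  obtain ⟨C, hC⟩ := hK.exists_bound_of_continuousOn
    (hf.comp (Continuous.prodMk_right x)).continuousOn
  refine ⟨C + 1, hK.eventually_forall_of_forall_eventually fun t ht => ?_⟩
  exact (hf.norm.tendsto (x, t)).eventually_le_const ((hC t ht).trans_lt (lt_add_one C))

variable {V F : Type*} [NormedAddCommGroup V] [NormedSpace ℝ V]
  [NormedAddCommGroup F] [NormedSpace ℝ F]

theorem hasFDerivAt_intervalIntegral_of_contDiff {f : V × ℝ → F} (hf : ContDiff ℝ 1 f)
    (a b : ℝ) (x : V) :
    HasFDerivAt (fun x => ∫ t in a..b, f (x, t))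
      (∫ t in a..b, (fderiv ℝ f (x, t)).comp (ContinuousLinearMap.inl ℝ V ℝ)) x := by
  have hf' : Continuous fun z : V × ℝ =>
      (fderiv ℝ f z).comp (ContinuousLinearMap.inl ℝ V ℝ) :=
    (hf.continuous_fderiv (by simp)).clm_comp continuous_const
  obtain ⟨C, hC⟩ := eventually_norm_le_of_continuous hf' (isCompact_uIcc (a := a) (b := b)) x
  refine intervalIntegral.hasFDerivAt_integral_of_dominated_of_fderiv_le
    (μ := MeasureTheory.volume) (F := fun x t => f (x, t))
    (F' := fun x t => (fderiv ℝ f (x, t)).comp (ContinuousLinearMap.inl ℝ V ℝ))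
    (bound := fun _ => C) hC ?_ ?_ ?_ ?_ ?_ ?_
  · exact .of_forall fun y => (hf.continuous.comp (by fun_prop)).aestronglyMeasurable
  · exact (hf.continuous.comp (by fun_prop)).intervalIntegrable _ _
  · exact (hf'.comp (by fun_prop : Continuous fun t : ℝ => (x, t))).aestronglyMeasurable
  · exact .of_forall fun t ht y hy => hy t (Set.uIoc_subset_uIcc ht)
  · exact continuous_const.intervalIntegrable _ _
  · refine .of_forall fun t _ y _ => ?_
    exact (hf.differentiable (by simp) (y, t)).hasFDerivAt.comp y (hasFDerivAt_prodMk_left y t)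

theorem fderiv_intervalIntegral_apply {f : V × ℝ → F} (hf : ContDiff ℝ 1 f)
    (a b : ℝ) (x v : V) :
    fderiv ℝ (fun x => ∫ t in a..b, f (x, t)) x v = ∫ t in a..b, fderiv ℝ f (x, t) (v, 0) := by
  have hf' : Continuous fun t : ℝ =>
      (fderiv ℝ f (x, t)).comp (ContinuousLinearMap.inl ℝ V ℝ) :=
    ((hf.continuous_fderiv (by simp)).comp (by fun_prop : Continuous fun t : ℝ => (x, t))).clm_comp
      continuous_const
  rw [(hasFDerivAt_intervalIntegral_of_contDiff hf a b x).fderiv,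
    ContinuousLinearMap.intervalIntegral_apply (hf'.intervalIntegrable a b)]
  simp

theorem contDiff_intervalIntegral [FiniteDimensional ℝ V] {f : V × ℝ → F}
    (hf : ContDiff ℝ ∞ f) (a b : ℝ) : ContDiff ℝ ∞ fun x => ∫ t in a..b, f (x, t) := by
  refine contDiff_infty.2 fun n => ?_
  induction n generalizing f with
  | zero =>
    exact contDiff_zero.2 (continuous_iff_continuousAt.2 fun x =>
      (hasFDerivAt_intervalIntegral_of_contDiff (hf.of_le (by simp)) a b x).continuousAt)
  | succ n ih =>
    push_cast
    refine contDiff_succ_iff_fderiv_apply.2 ⟨fun x => (hasFDerivAt_intervalIntegral_of_contDiff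
      (hf.of_le (by simp)) a b x).differentiableAt, by simp, fun v => ?_⟩
    simp only [fderiv_intervalIntegral_apply (hf.of_le (by simp)) a b]
    exact ih ((hf.fderiv_right (m := ∞) (by simp)).clm_apply contDiff_const)

theorem exists_contDiff_eq_add_smul [CompleteSpace F] {c : ℝ → F} (hc : ContDiff ℝ ∞ c) :
    ∃ e : ℝ → F, ContDiff ℝ ∞ e ∧ (∀ t, c t = c 0 + t • e t) ∧ e 0 = deriv c 0 := by
  have hd : ContDiff ℝ ∞ (deriv c) := (contDiff_infty_iff_deriv.1 hc).2
  -- Hadamard's lemma: `c t - c 0 = ∫ s in 0..1, t • c' (t * s)`.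
  refine ⟨fun t => ∫ s in (0 : ℝ)..1, deriv c (t * s), ?_, fun t => ?_, by simp⟩
  · exact contDiff_intervalIntegral (f := fun z : ℝ × ℝ => deriv c (z.1 * z.2))
      (hd.comp (by fun_prop)) 0 1
  · have hderiv (s : ℝ) : HasDerivAt (fun s => c (t * s)) (t • deriv c (t * s)) s := by
      simpa [Function.comp_def] using ((hc.differentiable (by simp)) (t * s)).hasDerivAt.scomp s
        ((hasDerivAt_id s).const_mul t)
    rw [← intervalIntegral.integral_smul, intervalIntegral.integral_eq_sub_of_hasDerivAt
      (fun s _ => hderiv s)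
      (((hd.continuous.comp (by fun_prop)).const_smul t).intervalIntegrable _ _)]
    simp

end ParametricIntegrals

/-! ### Smooth maps and directional derivatives -/

section SmoothMaps

variable {V W X Y : Type*} [NormedAddCommGroup V] [NormedSpace ℝ V]
  [NormedAddCommGroup W] [NormedSpace ℝ W]
  [DiffeologicalSpace X] [DiffeologicalSpace Y]

/-- Smooth maps from a normed space to a diffeological space. This is `DSmooth` for the standard
diffeology of `V`, which is not an instance on products such as `V × ℝ`. -/
def Smooth (f : V → X) : Prop := ∀ (m : ℕ) (g : Euc m → V), ContDiff ℝ ∞ g → IsPlot (f ∘ g)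

/-- Smoothness near a point, encoded as agreement near that point with a globally smooth map. -/
def SmoothAt (f : V → X) (x : V) : Prop := ∃ f' : V → X, Smooth f' ∧ f' =ᶠ[𝓝 x] f

theorem Smooth.smoothAt {f : V → X} (hf : Smooth f) (x : V) : SmoothAt f x := ⟨f, hf, .rfl⟩

theorem smooth_iff_isPlot {m : ℕ} {p : Euc m → X} : Smooth p ↔ IsPlot p :=
  ⟨fun h => h m id contDiff_id, fun h _ _ hg => isPlot_reparam h hg⟩

theorem smooth_const (a : X) : Smooth fun _ : V => a := fun _ _ _ => isPlot_const

theorem smoothAt_const (a : X) (x : V) : SmoothAt (fun _ => a) x := (smooth_const a).smoothAt x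

theorem Smooth.comp {f : V → X} (hf : Smooth f) {g : W → V} (hg : ContDiff ℝ ∞ g) :
    Smooth (f ∘ g) :=
  fun m h hh => hf m (g ∘ h) (hg.comp hh)

theorem SmoothAt.comp {f : V → X} {g : W → V} {x : W} (hf : SmoothAt f (g x))
    (hg : ContDiff ℝ ∞ g) : SmoothAt (fun y => f (g y)) x :=
  let ⟨f', hf', heq⟩ := hf
  ⟨f' ∘ g, hf'.comp hg, hg.continuous.continuousAt.eventually heq⟩

theorem SmoothAt.comp_fst {f : V → X} {x : V} (hf : SmoothAt f x) (y : W) :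
    SmoothAt (fun z : V × W => f z.1) (x, y) :=
  SmoothAt.comp (x := (x, y)) hf contDiff_fst

theorem SmoothAt.comp_snd {f : V → X} {x : V} (hf : SmoothAt f x) (y : W) :
    SmoothAt (fun z : W × V => f z.2) (y, x) :=
  SmoothAt.comp (x := (y, x)) hf contDiff_snd

theorem SmoothAt.congr {f g : V → X} {x : V} (hf : SmoothAt f x) (h : f =ᶠ[𝓝 x] g) :
    SmoothAt g x :=
  let ⟨f', hf', heq⟩ := hf
  ⟨f', hf', heq.trans h⟩

theorem smooth_of_forall_smoothAt {f : V → X} (hf : ∀ x, SmoothAt f x) : Smooth f := by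
  intro m g hg
  refine DiffeologicalSpace.locality fun y => ?_
  obtain ⟨f', hf', heq⟩ := hf (g y)
  obtain ⟨u, hu, hou, hyu⟩ := eventually_nhds_iff.1 (hg.continuous.continuousAt.eventually heq)
  refine ⟨u, hou, hyu, fun {k h} hh hs => ?_⟩
  rw [show (f ∘ g) ∘ h = f' ∘ (g ∘ h) from funext fun z => (hu _ (hh z)).symm]
  exact hf' k _ (hg.comp hs)

theorem SmoothAt.dSmooth_comp {f : V → X} {x : V} (hf : SmoothAt f x) {F : X → Y}
    (hF : DSmooth F) : SmoothAt (fun y => F (f y)) x :=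
  let ⟨f', hf', heq⟩ := hf
  ⟨F ∘ f', fun m g hg => hF m _ (hf' m g hg), heq.fun_comp F⟩

theorem SmoothAt.mul {H : Type*} [Group H] [DiffeologicalSpace H] [DiffeologicalGroup H]
    {f g : V → H} {x : V} (hf : SmoothAt f x) (hg : SmoothAt g x) :
    SmoothAt (fun y => f y * g y) x :=
  let ⟨f', hf', hff'⟩ := hf
  let ⟨g', hg', hgg'⟩ := hg
  ⟨fun y => f' y * g' y, fun m k hk => DiffeologicalGroup.mul_plot (hf' m k hk) (hg' m k hk),
    hff'.mul hgg'⟩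

theorem SmoothAt.inv {H : Type*} [Group H] [DiffeologicalSpace H] [DiffeologicalGroup H]
    {f : V → H} {x : V} (hf : SmoothAt f x) : SmoothAt (fun y => (f y)⁻¹) x :=
  let ⟨f', hf', heq⟩ := hf
  ⟨fun y => (f' y)⁻¹, fun m k hk => DiffeologicalGroup.inv_plot (hf' m k hk), heq.inv⟩

variable [FiniteDimensional ℝ V]

theorem Smooth.isOpen_preimage {f : V → X} (hf : Smooth f) {U : Set X}
    (hU : IsOpen[dTopology] U) : IsOpen (f ⁻¹' U) := by
  have h := (isOpen_iff_preimages_plots.1 hU _ _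
    (hf _ _ (toEuclidean (E := V)).symm.contDiff)).preimage (toEuclidean (E := V)).continuous
  simpa [← Set.preimage_comp, Function.comp_assoc] using h

theorem SmoothAt.eventually_mem {f : V → X} {x : V} (hf : SmoothAt f x) {U : Set X}
    (hU : IsOpen[dTopology] U) (hx : f x ∈ U) : ∀ᶠ y in 𝓝 x, f y ∈ U := by
  obtain ⟨f', hf', heq⟩ := hf
  have hmem : f' ⁻¹' U ∈ 𝓝 x := (hf'.isOpen_preimage hU).mem_nhds (by
    rwa [Set.mem_preimage, heq.self_of_nhds])
  filter_upwards [heq, hmem] with y hy hyU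
  rwa [← hy]

theorem exists_contDiff_eventuallyEq_id {x : V} {u : Set V} (hu : u ∈ 𝓝 x) :
    ∃ ρ : V → V, ContDiff ℝ ∞ ρ ∧ ρ =ᶠ[𝓝 x] id ∧ ∀ y, ρ y ∈ u := by
  obtain ⟨ε, hε, hεu⟩ := Metric.mem_nhds_iff.1 hu
  let b : ContDiffBump x := ⟨ε / 3, ε / 2, by positivity, by linarith⟩
  refine ⟨fun y => x + b y • (y - x), ?_, ?_, fun y => hεu ?_⟩
  · exact contDiff_const.add (b.contDiff.smul (contDiff_id.sub contDiff_const))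
  · filter_upwards [b.eventuallyEq_one] with y hy
    simp [hy]
  · rw [Metric.mem_ball, dist_eq_norm, add_sub_cancel_left, norm_smul, Real.norm_eq_abs,
      abs_of_nonneg b.nonneg]
    by_cases hy : dist y x < ε / 2
    · rw [dist_eq_norm] at hy
      linarith [mul_le_of_le_one_left (norm_nonneg (y - x)) (b.le_one (x := y))]
    · rw [b.zero_of_le_dist (not_lt.1 hy)]
      simpa using hε

theorem SmoothAt.smoothOn_comp {f : V → X} {x : V} (hf : SmoothAt f x) {U : Set X}
    (hU : IsOpen[dTopology] U) (hx : f x ∈ U) {F : X → Y} (hF : SmoothOn F U) :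
    SmoothAt (fun y => F (f y)) x := by
  obtain ⟨f', hf', heq⟩ := hf
  have hf'x : f' x ∈ U := by rwa [heq.self_of_nhds]
  -- `F ∘ f'` is smooth only where `f'` lies in `U`, so first retract `V` into `f' ⁻¹' U`.
  obtain ⟨ρ, hρ, hρx, hρU⟩ := exists_contDiff_eventuallyEq_id
    ((hf'.smoothAt x).eventually_mem hU hf'x)
  refine ⟨fun y => F (f' (ρ y)), fun m g hg => ?_, ?_⟩
  · exact hF m (f' ∘ (ρ ∘ g)) (hf' _ _ (hρ.comp hg)) fun y => hρU _
  · filter_upwards [heq, hρx] with y hy hρy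
    rw [hρy, id, hy]

theorem smooth_iff_contDiff {f : V → ℝ} : Smooth f ↔ ContDiff ℝ ∞ f := by
  refine ⟨fun h => ?_, fun h m g hg => (h.comp hg).isPlot⟩
  have := (h _ _ (toEuclidean (E := V)).symm.contDiff).contDiff.comp
    (toEuclidean (E := V)).contDiff
  simpa [Function.comp_def] using this

theorem smoothAt_of_contDiff {f : V → ℝ} (hf : ContDiff ℝ ∞ f) (x : V) : SmoothAt f x :=
  (smooth_iff_contDiff.2 hf).smoothAt x

theorem SmoothAt.contDiffAt {f : V → ℝ} {x : V} (hf : SmoothAt f x) : ContDiffAt ℝ ∞ f x :=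
  let ⟨_, hf', heq⟩ := hf
  (smooth_iff_contDiff.1 hf').contDiffAt.congr_of_eventuallyEq heq.symm

end SmoothMaps

section DirectionalDerivative

variable {V E : Type*} [NormedAddCommGroup V] [NormedSpace ℝ V]
  [AddCommGroup E] [Module ℝ E] [DiffeologicalSpace E]

/-- The derivative at `x` in the direction `v` of a map with values in a convenient space, with
the junk value `0` of `curveDeriv` where it does not exist. -/
noncomputable def dirDeriv (f : V → E) (x v : V) : E := curveDeriv fun t => f (x + t • v)

theorem curveDeriv_eq_dirDeriv (c : ℝ → E) : curveDeriv c = dirDeriv c 0 1 := by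
  simp [dirDeriv]

open Classical in
theorem curveDeriv_congr {c c' : ℝ → E} (h : c =ᶠ[𝓝 0] c') : curveDeriv c = curveDeriv c' := by
  have hpred : (fun v : E => ∀ ℓ : E →ₗ[ℝ] ℝ, DSmooth ℓ → HasDerivAt (fun t => ℓ (c t)) (ℓ v) 0) =
      fun v => ∀ ℓ : E →ₗ[ℝ] ℝ, DSmooth ℓ → HasDerivAt (fun t => ℓ (c' t)) (ℓ v) 0 :=
    funext fun _ => propext <| forall₂_congr fun ℓ _ => (h.fun_comp ℓ).hasDerivAt_iff
  have dite_congr (p q : E → Prop) (hpq : p = q) :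
      (if h : ∃ v, p v then h.choose else 0) = if h : ∃ v, q v then h.choose else 0 := by rw [hpq]
  exact dite_congr _ _ hpred

theorem dirDeriv_congr {f g : V → E} {x : V} (h : f =ᶠ[𝓝 x] g) (v : V) :
    dirDeriv f x v = dirDeriv g x v := by
  refine curveDeriv_congr ?_
  have hline : ContinuousAt (fun t : ℝ => x + t • v) 0 := by fun_prop
  exact hline.eventually (p := fun y => f y = g y) (by
    simp only [zero_smul, add_zero]; exact h)

theorem dirDeriv_fst {W : Type*} [NormedAddCommGroup W] [NormedSpace ℝ W] (F : V → W → E)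
    (x v : V) (y : W) :
    dirDeriv (fun x => F x y) x v = dirDeriv (fun z : V × W => F z.1 z.2) (x, y) (v, 0) := by
  simp [dirDeriv]

theorem dirDeriv_snd {W : Type*} [NormedAddCommGroup W] [NormedSpace ℝ W] (F : V → W → E)
    (x : V) (y w : W) :
    dirDeriv (F x) y w = dirDeriv (fun z : V × W => F z.1 z.2) (x, y) (0, w) := by
  simp [dirDeriv]

end DirectionalDerivative

section Functionals

variable {V E : Type*} [NormedAddCommGroup V] [NormedSpace ℝ V]
  [AddCommGroup E] [Module ℝ E] [DiffeologicalSpace E]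

theorem Smooth.contDiff [FiniteDimensional ℝ V] {f : V → E} (hf : Smooth f) {ℓ : E →ₗ[ℝ] ℝ}
    (hℓ : DSmooth ℓ) : ContDiff ℝ ∞ fun x => ℓ (f x) :=
  smooth_iff_contDiff.1 fun m g hg => hℓ m _ (hf m g hg)

theorem SmoothAt.differentiableAt [FiniteDimensional ℝ V] {f : V → E} {x : V}
    (hf : SmoothAt f x) {ℓ : E →ₗ[ℝ] ℝ} (hℓ : DSmooth ℓ) :
    DifferentiableAt ℝ (fun x => ℓ (f x)) x :=
  (hf.dSmooth_comp hℓ).contDiffAt.differentiableAt (by simp)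

variable [ConvenientSpace E]

theorem eq_of_forall_functional {v w : E} (h : ∀ ℓ : E →ₗ[ℝ] ℝ, DSmooth ℓ → ℓ v = ℓ w) :
    v = w := by
  by_contra hne
  obtain ⟨ℓ, hℓ, hℓ0⟩ := ConvenientSpace.separated (v - w) (sub_ne_zero.2 hne)
  exact hℓ0 (by rw [map_sub, h ℓ hℓ, sub_self])

theorem smooth_of_forall_functional {f : V → E}
    (h : ∀ ℓ : E →ₗ[ℝ] ℝ, DSmooth ℓ → ContDiff ℝ ∞ fun x => ℓ (f x)) : Smooth f :=
  fun _ _ hg => ConvenientSpace.plot_of_scalarwise _ fun ℓ hℓ => (h ℓ hℓ).comp hg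

theorem dirDeriv_eq_of_forall_functional {f : V → E} {x v : V} {ξ : E}
    (h : ∀ ℓ : E →ₗ[ℝ] ℝ, DSmooth ℓ → HasDerivAt (fun t : ℝ => ℓ (f (x + t • v))) (ℓ ξ) 0) :
    dirDeriv f x v = ξ := by
  have hex : ∃ v' : E, ∀ ℓ : E →ₗ[ℝ] ℝ, DSmooth ℓ →
      HasDerivAt (fun t : ℝ => ℓ (f (x + t • v))) (ℓ v') 0 := ⟨ξ, h⟩
  rw [dirDeriv, curveDeriv, dif_pos hex]
  exact eq_of_forall_functional fun ℓ hℓ => (hex.choose_spec ℓ hℓ).unique (h ℓ hℓ)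

theorem SmoothAt.apply_dirDeriv [FiniteDimensional ℝ V] {f : V → E} {x : V} (hf : SmoothAt f x)
    (v : V) {ℓ : E →ₗ[ℝ] ℝ} (hℓ : DSmooth ℓ) :
    ℓ (dirDeriv f x v) = fderiv ℝ (fun y => ℓ (f y)) x v := by
  obtain ⟨f', hf', heq⟩ := hf
  have hℓeq : (fun y => ℓ (f' y)) =ᶠ[𝓝 x] fun y => ℓ (f y) := heq.fun_comp ℓ
  rw [← dirDeriv_congr heq, ← hℓeq.fderiv_eq]
  have hline : ContDiff ℝ ∞ fun t : ℝ => x + t • v := by fun_prop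
  obtain ⟨ξ, hξ⟩ := ConvenientSpace.exists_deriv (fun t : ℝ => f' (x + t • v))
    fun ℓ hℓ => (hf'.contDiff hℓ).comp hline
  rw [dirDeriv_eq_of_forall_functional hξ]
  have hchain := ((hf'.contDiff hℓ).differentiable (by simp)
    (x + (0 : ℝ) • v)).hasFDerivAt.comp_hasDerivAt (0 : ℝ)
      (((hasDerivAt_id (0 : ℝ)).smul_const v).const_add x)
  simpa [Function.comp_def] using (hξ ℓ hℓ).unique hchain

end Functionals

section Calculus

variable {V W E : Type*} [NormedAddCommGroup V] [NormedSpace ℝ V] [FiniteDimensional ℝ V]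
  [NormedAddCommGroup W] [NormedSpace ℝ W]
  [AddCommGroup E] [Module ℝ E] [DiffeologicalSpace E] [ConvenientSpace E]

theorem SmoothAt.add {f g : V → E} {x : V} (hf : SmoothAt f x) (hg : SmoothAt g x) :
    SmoothAt (fun y => f y + g y) x :=
  let ⟨f', hf', hff'⟩ := hf
  let ⟨g', hg', hgg'⟩ := hg
  ⟨fun y => f' y + g' y, smooth_of_forall_functional fun ℓ hℓ => by
    simpa using (hf'.contDiff hℓ).add (hg'.contDiff hℓ), hff'.add hgg'⟩

theorem SmoothAt.smul {f : V → ℝ} {g : V → E} {x : V} (hf : SmoothAt f x) (hg : SmoothAt g x) :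
    SmoothAt (fun y => f y • g y) x :=
  let ⟨f', hf', hff'⟩ := hf
  let ⟨g', hg', hgg'⟩ := hg
  ⟨fun y => f' y • g' y, smooth_of_forall_functional fun ℓ hℓ => by
    simpa using (smooth_iff_contDiff.1 hf').mul (hg'.contDiff hℓ), hff'.smul hgg'⟩

theorem SmoothAt.neg {f : V → E} {x : V} (hf : SmoothAt f x) : SmoothAt (fun y => -f y) x := by
  simpa using SmoothAt.smul (smoothAt_const (-1 : ℝ) x) hf

theorem SmoothAt.sub {f g : V → E} {x : V} (hf : SmoothAt f x) (hg : SmoothAt g x) :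
    SmoothAt (fun y => f y - g y) x := by
  simpa [sub_eq_add_neg] using hf.add hg.neg

theorem SmoothAt.sum {ι : Type*} (s : Finset ι) {f : ι → V → E} {x : V}
    (hf : ∀ i ∈ s, SmoothAt (f i) x) : SmoothAt (fun y => ∑ i ∈ s, f i y) x := by
  classical
  induction s using Finset.induction_on with
  | empty => simpa using smoothAt_const (0 : E) x
  | insert a s ha ih =>
    simp only [Finset.sum_insert ha]
    exact SmoothAt.add (hf a (Finset.mem_insert_self a s))
      (ih fun i hi => hf i (Finset.mem_insert_of_mem hi))

theorem dSmooth_lsmul (a : ℝ) : DSmooth (LinearMap.lsmul ℝ E a) := fun _ _ hp =>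
  smooth_iff_isPlot.1 <| smooth_of_forall_smoothAt fun x =>
    (smoothAt_const a x).smul ((smooth_iff_isPlot.2 hp).smoothAt x)

theorem dirDeriv_add_right {f : V → E} {x : V} (hf : SmoothAt f x) (v w : V) :
    dirDeriv f x (v + w) = dirDeriv f x v + dirDeriv f x w :=
  eq_of_forall_functional fun ℓ hℓ => by simp [hf.apply_dirDeriv _ hℓ]

theorem dirDeriv_smul_right {f : V → E} {x : V} (hf : SmoothAt f x) (a : ℝ) (v : V) :
    dirDeriv f x (a • v) = a • dirDeriv f x v :=
  eq_of_forall_functional fun ℓ hℓ => by simp [hf.apply_dirDeriv _ hℓ]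

theorem dirDeriv_const (a : E) (x v : V) : dirDeriv (fun _ => a) x v = 0 :=
  eq_of_forall_functional fun ℓ hℓ => by simp [(smoothAt_const a x).apply_dirDeriv _ hℓ]

theorem dirDeriv_add {f g : V → E} {x : V} (hf : SmoothAt f x) (hg : SmoothAt g x) (v : V) :
    dirDeriv (fun y => f y + g y) x v = dirDeriv f x v + dirDeriv g x v :=
  eq_of_forall_functional fun ℓ hℓ => by
    simp [(hf.add hg).apply_dirDeriv _ hℓ, hf.apply_dirDeriv _ hℓ, hg.apply_dirDeriv _ hℓ,
      fderiv_fun_add (hf.differentiableAt hℓ) (hg.differentiableAt hℓ)]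

theorem dirDeriv_map {f : V → E} {x : V} (hf : SmoothAt f x) {L : E →ₗ[ℝ] E} (hL : DSmooth L)
    (v : V) : dirDeriv (fun y => L (f y)) x v = L (dirDeriv f x v) :=
  eq_of_forall_functional fun ℓ hℓ => by
    rw [(hf.dSmooth_comp hL).apply_dirDeriv _ hℓ]
    exact (hf.apply_dirDeriv v (ℓ := ℓ ∘ₗ L) (hℓ.comp hL)).symm

theorem dirDeriv_const_smul {f : V → E} {x : V} (hf : SmoothAt f x) (a : ℝ) (v : V) :
    dirDeriv (fun y => a • f y) x v = a • dirDeriv f x v :=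
  dirDeriv_map hf (dSmooth_lsmul a) v

theorem dirDeriv_neg {f : V → E} {x : V} (hf : SmoothAt f x) (v : V) :
    dirDeriv (fun y => -f y) x v = -dirDeriv f x v := by
  simpa using dirDeriv_const_smul hf (-1) v

theorem dirDeriv_sub {f g : V → E} {x : V} (hf : SmoothAt f x) (hg : SmoothAt g x) (v : V) :
    dirDeriv (fun y => f y - g y) x v = dirDeriv f x v - dirDeriv g x v := by
  simp only [sub_eq_add_neg]
  rw [dirDeriv_add hf hg.neg, dirDeriv_neg hg]

theorem dirDeriv_comp [FiniteDimensional ℝ W] {f : V → E} {g : W → V} {x : W}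
    (hf : SmoothAt f (g x)) (hg : ContDiff ℝ ∞ g) (v : W) :
    dirDeriv (fun y => f (g y)) x v = dirDeriv f (g x) (fderiv ℝ g x v) :=
  eq_of_forall_functional fun ℓ hℓ => by
    rw [(hf.comp hg).apply_dirDeriv _ hℓ, hf.apply_dirDeriv _ hℓ]
    exact congr($(((hf.differentiableAt hℓ).hasFDerivAt.comp x
      (hg.differentiable (by simp) x).hasFDerivAt).fderiv) v)

theorem smoothAt_dirDeriv {f : V → E} {g h : W → V} {y : W} (hf : SmoothAt f (g y))
    (hg : ContDiff ℝ ∞ g) (hh : ContDiff ℝ ∞ h) :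
    SmoothAt (fun z => dirDeriv f (g z) (h z)) y := by
  obtain ⟨f', hf', heq⟩ := hf
  refine ⟨fun z => dirDeriv f' (g z) (h z), ?_, ?_⟩
  · refine smooth_of_forall_functional fun ℓ hℓ => ?_
    simp only [(hf'.smoothAt _).apply_dirDeriv _ hℓ]
    exact (((hf'.contDiff hℓ).fderiv_right (m := ∞) (by simp)).comp hg).clm_apply hh
  · exact (hg.continuous.continuousAt.eventually heq.eventually_nhds).mono
      fun z hz => dirDeriv_congr hz _

theorem dirDeriv_dirDeriv_comm {f : V → E} {x : V} (hf : SmoothAt f x) (v w : V) :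
    dirDeriv (fun y => dirDeriv f y w) x v = dirDeriv (fun y => dirDeriv f y v) x w := by
  obtain ⟨f', hf', heq⟩ := hf
  have hcongr (w : V) : (fun y => dirDeriv f' y w) =ᶠ[𝓝 x] fun y => dirDeriv f y w :=
    heq.eventually_nhds.mono fun y hy => dirDeriv_congr hy _
  rw [← dirDeriv_congr (hcongr w), ← dirDeriv_congr (hcongr v)]
  have hsmooth (w : V) : SmoothAt (fun y => dirDeriv f' y w) x :=
    smoothAt_dirDeriv (g := id) (hf'.smoothAt x) contDiff_id contDiff_const
  refine eq_of_forall_functional fun ℓ hℓ => ?_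
  rw [(hsmooth w).apply_dirDeriv _ hℓ, (hsmooth v).apply_dirDeriv _ hℓ]
  simp only [(hf'.smoothAt _).apply_dirDeriv _ hℓ]
  have hC := hf'.contDiff hℓ
  have hd : DifferentiableAt ℝ (fderiv ℝ fun y => ℓ (f' y)) x :=
    (hC.fderiv_right (m := ∞) (by simp)).differentiable (by simp) x
  rw [fderiv_clm_apply hd (by fun_prop), fderiv_clm_apply hd (by fun_prop)]
  have hsymm := hC.contDiffAt.isSymmSndFDerivAt (x := x) (by
    rw [minSmoothness_of_isRCLikeNormedField]; exact WithTop.coe_le_coe.2 (le_top (a := (2 : ℕ∞))))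
  simpa using hsymm v w

theorem smoothAt_dirDeriv_fst [FiniteDimensional ℝ W] {F : V → W → E} {x : V} {y : W}
    (hF : SmoothAt (fun z : V × W => F z.1 z.2) (x, y)) (v : V) :
    SmoothAt (fun z : V × W => dirDeriv (fun x => F x z.2) z.1 v) (x, y) := by
  simp only [dirDeriv_fst F]
  exact smoothAt_dirDeriv (g := fun z : V × W => z) hF contDiff_id contDiff_const

theorem smoothAt_dirDeriv_snd [FiniteDimensional ℝ W] {F : V → W → E} {x : V} {y : W}
    (hF : SmoothAt (fun z : V × W => F z.1 z.2) (x, y)) (w : W) :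
    SmoothAt (fun z : V × W => dirDeriv (F z.1) z.2 w) (x, y) := by
  simp only [dirDeriv_snd F]
  exact smoothAt_dirDeriv (g := fun z : V × W => z) hF contDiff_id contDiff_const

theorem dirDeriv_partial_comm [FiniteDimensional ℝ W] {F : V → W → E} {x : V} {y : W}
    (hF : SmoothAt (fun z : V × W => F z.1 z.2) (x, y)) (v : V) (w : W) :
    dirDeriv (fun x => dirDeriv (F x) y w) x v =
      dirDeriv (fun y => dirDeriv (fun x => F x y) x v) y w := by
  rw [dirDeriv_fst (fun (x : V) (y : W) => dirDeriv (F x) y w),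
    dirDeriv_snd (fun (x : V) (y : W) => dirDeriv (fun x => F x y) x v)]
  simp only [dirDeriv_snd F, dirDeriv_fst F]
  exact dirDeriv_dirDeriv_comm hF (v, 0) (0, w)

theorem dirDeriv_diag {f : V → V → E} {x : V}
    (hf : SmoothAt (fun z : V × V => f z.1 z.2) (x, x)) (v : V) :
    dirDeriv (fun y => f y y) x v =
      dirDeriv (fun y => f y x) x v + dirDeriv (fun y => f x y) x v := by
  rw [dirDeriv_fst f, dirDeriv_snd f, ← dirDeriv_add_right hf,
    dirDeriv_comp (g := fun y : V => (y, y)) hf (by fun_prop),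
    HasFDerivAt.fderiv (f := fun y : V => (y, y)) ((hasFDerivAt_id x).prodMk (hasFDerivAt_id x))]
  simp

theorem SmoothAt.exists_eq_add_smul {c : ℝ → E} (hc : SmoothAt c 0) :
    ∃ e : ℝ → E, Smooth e ∧ (∀ᶠ t in 𝓝 0, c t = c 0 + t • e t) ∧ e 0 = curveDeriv c := by
  obtain ⟨c', hc', heq⟩ := hc
  rw [← curveDeriv_congr heq, curveDeriv_eq_dirDeriv]
  let e : ℝ → E := fun t => if t = 0 then dirDeriv c' 0 1 else t⁻¹ • (c' t - c' 0)
  refine ⟨e, smooth_of_forall_functional fun ℓ hℓ => ?_, ?_, by simp [e]⟩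
  · obtain ⟨k, hk, hck, hk0⟩ := exists_contDiff_eq_add_smul (hc'.contDiff hℓ)
    convert hk using 1
    funext t
    by_cases ht : t = 0
    · simp [e, ht, hk0, (hc'.smoothAt 0).apply_dirDeriv _ hℓ]
    · simp [e, ht, hck t]
  · filter_upwards [heq] with t ht
    rw [← ht, ← heq.self_of_nhds]
    by_cases h : t = 0 <;> simp [e, h]

theorem smoothAt_clm_smul (L : V →L[ℝ] ℝ) (ξ : E) (x : V) : SmoothAt (fun y => L y • ξ) x :=
  (smoothAt_of_contDiff L.contDiff x).smul (smoothAt_const ξ x)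

theorem dirDeriv_clm_smul (L : V →L[ℝ] ℝ) (ξ : E) (x v : V) :
    dirDeriv (fun y => L y • ξ) x v = L v • ξ := by
  refine eq_of_forall_functional fun ℓ hℓ => ?_
  rw [(smoothAt_clm_smul L ξ x).apply_dirDeriv v hℓ]
  simp only [map_smul, smul_eq_mul]
  rw [fderiv_mul_const L.differentiableAt, L.fderiv]
  simp [mul_comm]

end Calculus

/-! ### Calculus on a Lie group in a chart -/

namespace LieChart

section Differential

variable {H E : Type*} [Group H] [DiffeologicalSpace H]
  [AddCommGroup E] [Module ℝ E] [DiffeologicalSpace E] (φ : LieChart H E)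

/-- The differential at `1` of a map on `H`, on the Lie algebra `E`. -/
noncomputable def differential (Ψ : H → E) (ξ : E) : E := curveDeriv fun t => Ψ (φ.curve ξ t)

theorem invFun_chart_one : φ.invFun (φ.toFun 1) = 1 := φ.left_inv φ.one_mem

theorem curve_zero (ξ : E) : φ.curve ξ 0 = 1 := by simp [curve, invFun_chart_one]

variable {V : Type*} [NormedAddCommGroup V] [NormedSpace ℝ V] [FiniteDimensional ℝ V]

theorem smoothAt_chart {a : V → H} {x : V} (ha : SmoothAt a x) (hx : a x ∈ φ.source) :
    SmoothAt (fun y => φ.toFun (a y)) x :=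
  ha.smoothOn_comp φ.open_source hx φ.smooth_toFun

theorem smoothAt_chart_of_eq_one {a : V → H} {x : V} (ha : SmoothAt a x) (hx : a x = 1) :
    SmoothAt (fun y => φ.toFun (a y)) x :=
  φ.smoothAt_chart ha (hx ▸ φ.one_mem)

variable [ConvenientSpace E]

theorem smoothAt_invFun {ξ : V → E} {x : V} (hξ : SmoothAt ξ x) (hx : ξ x = 0) :
    SmoothAt (fun y => φ.invFun (φ.toFun 1 + ξ y)) x := by
  refine ((smoothAt_const (φ.toFun 1) x).add hξ).smoothOn_comp φ.open_target ?_ φ.smooth_invFun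
  rw [hx, add_zero]
  exact φ.map_source φ.one_mem

theorem eventually_chart_invFun {ξ : V → E} {x : V} (hξ : SmoothAt ξ x) (hx : ξ x = 0) :
    ∀ᶠ y in 𝓝 x, φ.toFun (φ.invFun (φ.toFun 1 + ξ y)) = φ.toFun 1 + ξ y := by
  have hmem := ((smoothAt_const (φ.toFun 1) x).add hξ).eventually_mem φ.open_target
    (by rw [hx, add_zero]; exact φ.map_source φ.one_mem)
  exact hmem.mono fun y hy => φ.right_inv hy

theorem dirDeriv_chart_invFun {ξ : V → E} {x : V} (hξ : SmoothAt ξ x) (hx : ξ x = 0) (v : V) :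
    dirDeriv (fun y => φ.toFun (φ.invFun (φ.toFun 1 + ξ y))) x v = dirDeriv ξ x v := by
  rw [dirDeriv_congr (φ.eventually_chart_invFun hξ hx),
    dirDeriv_add (smoothAt_const _ x) hξ, dirDeriv_const, zero_add]

theorem smoothAt_curve {ξ : V → E} {τ : V → ℝ} {x : V} (hξ : SmoothAt ξ x) (hτ : SmoothAt τ x)
    (hx : τ x = 0) : SmoothAt (fun y => φ.curve (ξ y) (τ y)) x :=
  φ.smoothAt_invFun (hτ.smul hξ) (by simp [hx])

theorem smoothAt_curve_zero (ξ : E) : SmoothAt (φ.curve ξ) 0 :=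
  φ.smoothAt_curve (smoothAt_const ξ _) (smoothAt_of_contDiff contDiff_id _) rfl

theorem dirDeriv_curve (ξ : E) : dirDeriv (fun t => φ.toFun (φ.curve ξ t)) 0 1 = ξ := by
  have h := φ.dirDeriv_chart_invFun (smoothAt_clm_smul (.id ℝ ℝ) ξ 0) (by simp) 1
  exact h.trans <| (dirDeriv_clm_smul (.id ℝ ℝ) ξ 0 1).trans (one_smul ℝ ξ)

theorem exists_family_dirDeriv_eq (ξ η : E) : ∃ k : ℝ × ℝ → H, SmoothAt k 0 ∧ k 0 = 1 ∧
    ∀ v : ℝ × ℝ, dirDeriv (fun y => φ.toFun (k y)) 0 v = v.1 • ξ + v.2 • η := by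
  have hfst : SmoothAt (fun z : ℝ × ℝ => z.1 • ξ) 0 := smoothAt_clm_smul (.fst ℝ ℝ ℝ) ξ 0
  have hsnd : SmoothAt (fun z : ℝ × ℝ => z.2 • η) 0 := smoothAt_clm_smul (.snd ℝ ℝ ℝ) η 0
  have hsum : SmoothAt (fun z : ℝ × ℝ => z.1 • ξ + z.2 • η) 0 := hfst.add hsnd
  refine ⟨fun z => φ.invFun (φ.toFun 1 + (z.1 • ξ + z.2 • η)),
    φ.smoothAt_invFun hsum (by simp), by simp [invFun_chart_one], fun v => ?_⟩
  rw [φ.dirDeriv_chart_invFun hsum (by simp), dirDeriv_add hfst hsnd]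
  exact congrArg₂ _ (dirDeriv_clm_smul (.fst ℝ ℝ ℝ) ξ 0 v) (dirDeriv_clm_smul (.snd ℝ ℝ ℝ) η 0 v)

section ChainRule

variable {Ψ : H → E} {S : Set H} (hS : IsOpen[dTopology] S) (hone : (1 : H) ∈ S)
  (hΨ : SmoothOn Ψ S)

include hS hone hΨ

omit [FiniteDimensional ℝ V] in
-- Hadamard's lemma writes `a (x + t • v)` as `φ.curve (e t) t` with `e` smooth, so the two
-- occurrences of `t` can be differentiated separately.
theorem dirDeriv_comp_eq_differential {a : V → H} {x : V} (ha : SmoothAt a x) (hx : a x = 1)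
    (v : V) :
    dirDeriv (fun y => Ψ (a y)) x v =
      φ.differential Ψ (dirDeriv (fun y => φ.toFun (a y)) x v) := by
  have hb : SmoothAt (fun t : ℝ => a (x + t • v)) 0 :=
    SmoothAt.comp (g := fun t : ℝ => x + t • v) (by simpa using ha) (by fun_prop)
  have hb1 : a (x + (0 : ℝ) • v) = 1 := by simpa using hx
  obtain ⟨e, he, hce, he0⟩ := (φ.smoothAt_chart_of_eq_one hb hb1).exists_eq_add_smul
  have hbe : (fun t : ℝ => Ψ (a (x + t • v))) =ᶠ[𝓝 0] fun t => Ψ (φ.curve (e t) t) := by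
    filter_upwards [hce, hb.eventually_mem φ.open_source (hb1 ▸ φ.one_mem)] with t ht hts
    rw [hb1] at ht
    rw [curve, ← ht]
    exact congrArg Ψ (φ.left_inv hts).symm
  have hF : SmoothAt (fun z : ℝ × ℝ => Ψ (φ.curve (e z.2) z.1)) ((0 : ℝ), (0 : ℝ)) := by
    refine (φ.smoothAt_curve ((he.smoothAt 0).comp_snd 0) (smoothAt_of_contDiff contDiff_fst _)
      rfl).smoothOn_comp hS ?_ hΨ
    simpa only [curve_zero] using hone
  have hdiag := dirDeriv_diag (f := fun s t => Ψ (φ.curve (e t) s)) hF 1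
  rw [dirDeriv, curveDeriv_congr hbe, curveDeriv_eq_dirDeriv, hdiag]
  simp only [curve_zero, dirDeriv_const, add_zero]
  rw [he0, differential, ← curveDeriv_eq_dirDeriv]
  rfl

theorem differential_smul_add_smul (a b : ℝ) (ξ η : E) :
    φ.differential Ψ (a • ξ + b • η) = a • φ.differential Ψ ξ + b • φ.differential Ψ η := by
  obtain ⟨k, hk, hk0, hkd⟩ := φ.exists_family_dirDeriv_eq ξ η
  have hchain (v : ℝ × ℝ) :
      dirDeriv (fun y => Ψ (k y)) 0 v = φ.differential Ψ (v.1 • ξ + v.2 • η) := by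
    rw [φ.dirDeriv_comp_eq_differential hS hone hΨ hk hk0, hkd]
  have hΨk : SmoothAt (fun y => Ψ (k y)) 0 := hk.smoothOn_comp hS (by rwa [hk0]) hΨ
  calc φ.differential Ψ (a • ξ + b • η)
      = dirDeriv (fun y => Ψ (k y)) 0 (a • (1, 0) + b • (0, 1)) := by simp [hchain]
    _ = a • φ.differential Ψ ξ + b • φ.differential Ψ η := by
      rw [dirDeriv_add_right hΨk, dirDeriv_smul_right hΨk, dirDeriv_smul_right hΨk]
      simp [hchain]

theorem differential_add (ξ η : E) :
    φ.differential Ψ (ξ + η) = φ.differential Ψ ξ + φ.differential Ψ η := by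
  simpa using φ.differential_smul_add_smul hS hone hΨ 1 1 ξ η

theorem differential_smul (a : ℝ) (ξ : E) :
    φ.differential Ψ (a • ξ) = a • φ.differential Ψ ξ := by
  simpa using φ.differential_smul_add_smul hS hone hΨ a 0 ξ 0

theorem differential_neg (ξ : E) : φ.differential Ψ (-ξ) = -φ.differential Ψ ξ := by
  simpa using φ.differential_smul hS hone hΨ (-1) ξ

end ChainRule

end Differential

variable {H E : Type*} [Group H] [DiffeologicalSpace H]
  [AddCommGroup E] [Module ℝ E] [DiffeologicalSpace E] (φ : LieChart H E)

section Translations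

variable [DiffeologicalGroup H]

theorem isOpen_translate (u w : H) : IsOpen[dTopology] {g : H | u * g * w ∈ φ.source} := by
  rw [isOpen_iff_preimages_plots]
  intro n p hp
  exact isOpen_iff_preimages_plots.1 φ.open_source n _
    (DiffeologicalGroup.mul_plot (DiffeologicalGroup.mul_plot isPlot_const hp) isPlot_const)

theorem smoothOn_translate (u w : H) :
    SmoothOn (fun g => φ.toFun (u * g * w)) {g : H | u * g * w ∈ φ.source} := fun m _ hp hU =>
  φ.smooth_toFun m _
    (DiffeologicalGroup.mul_plot (DiffeologicalGroup.mul_plot isPlot_const hp) isPlot_const) hU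

variable {V : Type*} [NormedAddCommGroup V] [NormedSpace ℝ V] [FiniteDimensional ℝ V]

theorem smoothAt_chart_mul {a b : V → H} {x : V} (ha : SmoothAt a x) (hb : SmoothAt b x)
    (hx : a x * b x = 1) : SmoothAt (fun z : V × V => φ.toFun (a z.1 * b z.2)) (x, x) :=
  φ.smoothAt_chart_of_eq_one ((ha.comp_fst x).mul (hb.comp_snd x)) hx

variable [ConvenientSpace E]

theorem dirDeriv_chart_mul {a b : V → H} {x : V} (ha : SmoothAt a x) (hb : SmoothAt b x)
    (hax : a x = 1) (hbx : b x = 1) (v : V) :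
    dirDeriv (fun y => φ.toFun (a y * b y)) x v =
      dirDeriv (fun y => φ.toFun (a y)) x v + dirDeriv (fun y => φ.toFun (b y)) x v := by
  rw [dirDeriv_diag (f := fun y z => φ.toFun (a y * b z))
    (φ.smoothAt_chart_mul ha hb (by simp [hax, hbx]))]
  simp [hax, hbx]

section InverseRules

variable {a : V → H} {x : V} (ha : SmoothAt a x) (hax : a x = 1)

include ha hax

theorem dirDeriv_chart_inv (v : V) :
    dirDeriv (fun y => φ.toFun (a y)⁻¹) x v = -dirDeriv (fun y => φ.toFun (a y)) x v := by
  have h := φ.dirDeriv_chart_mul ha ha.inv hax (by simp [hax]) v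
  simp only [mul_inv_cancel, dirDeriv_const] at h
  exact (neg_eq_of_add_eq_zero_right h.symm).symm

theorem dirDeriv_chart_translate_inv {u w : H} (huw : u * w ∈ φ.source) (v : V) :
    dirDeriv (fun y => φ.toFun (u * (a y)⁻¹ * w)) x v =
      -dirDeriv (fun y => φ.toFun (u * a y * w)) x v := by
  have hS := φ.isOpen_translate u w
  have hone : (1 : H) ∈ {g : H | u * g * w ∈ φ.source} := by simpa using huw
  have hΨ := φ.smoothOn_translate u w
  rw [φ.dirDeriv_comp_eq_differential hS hone hΨ ha.inv (by simp [hax]),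
    φ.dirDeriv_comp_eq_differential hS hone hΨ ha hax, φ.dirDeriv_chart_inv ha hax,
    φ.differential_neg hS hone hΨ]

theorem dirDeriv_chart_mul_inv {u : H} (hu : u ∈ φ.source) (v : V) :
    dirDeriv (fun y => φ.toFun (u * (a y)⁻¹)) x v =
      -dirDeriv (fun y => φ.toFun (u * a y)) x v := by
  simpa using φ.dirDeriv_chart_translate_inv ha hax (u := u) (w := 1) (by simpa using hu) v

theorem dirDeriv_chart_inv_mul {u : H} (hu : u ∈ φ.source) (v : V) :
    dirDeriv (fun y => φ.toFun ((a y)⁻¹ * u)) x v =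
      -dirDeriv (fun y => φ.toFun (a y * u)) x v := by
  simpa using φ.dirDeriv_chart_translate_inv ha hax (u := 1) (w := u) (by simpa using hu) v

end InverseRules

end Translations

section AdjointAction

variable [DiffeologicalGroup H] [ConvenientSpace E]
  {V : Type*} [NormedAddCommGroup V] [NormedSpace ℝ V] [FiniteDimensional ℝ V]

omit [FiniteDimensional ℝ V] in
theorem dirDeriv_conj {a : V → H} {x : V} (ha : SmoothAt a x) (hx : a x = 1) (h : H) (v : V) :
    dirDeriv (fun y => φ.toFun (h * a y * h⁻¹)) x v =
      φ.Ad h (dirDeriv (fun y => φ.toFun (a y)) x v) :=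
  φ.dirDeriv_comp_eq_differential (φ.isOpen_translate h h⁻¹) (by simp [φ.one_mem])
    (φ.smoothOn_translate h h⁻¹) ha hx v

theorem Ad_one (ξ : E) : φ.Ad 1 ξ = ξ := by
  simpa [dirDeriv_curve] using
    (φ.dirDeriv_conj (φ.smoothAt_curve_zero ξ) (φ.curve_zero ξ) 1 1).symm

theorem Ad_mul (g h : H) (ξ : E) : φ.Ad (g * h) ξ = φ.Ad g (φ.Ad h ξ) := by
  have hc := φ.smoothAt_curve_zero ξ
  have hconj := ((smoothAt_const h 0).mul hc).mul (smoothAt_const h⁻¹ 0)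
  calc φ.Ad (g * h) ξ
      = dirDeriv (fun t => φ.toFun (g * h * φ.curve ξ t * (g * h)⁻¹)) 0 1 := by
        rw [φ.dirDeriv_conj hc (φ.curve_zero ξ), dirDeriv_curve]
    _ = dirDeriv (fun t => φ.toFun (g * (h * φ.curve ξ t * h⁻¹) * g⁻¹)) 0 1 := by
        simp only [mul_inv_rev, mul_assoc]
    _ = φ.Ad g (φ.Ad h ξ) := by
        rw [φ.dirDeriv_conj hconj (by simp [curve_zero]), φ.dirDeriv_conj hc (φ.curve_zero ξ),
          dirDeriv_curve]

theorem smoothAt_Ad {h : V → H} {ξ : V → E} {x : V} (hh : SmoothAt h x) (hξ : SmoothAt ξ x) :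
    SmoothAt (fun y => φ.Ad (h y) (ξ y)) x := by
  have hconj : SmoothAt (fun z : V × ℝ => φ.toFun (h z.1 * φ.curve (ξ z.1) z.2 * (h z.1)⁻¹))
      (x, 0) := by
    have hh₁ : SmoothAt (fun z : V × ℝ => h z.1) (x, 0) := hh.comp_fst 0
    refine φ.smoothAt_chart_of_eq_one ((hh₁.mul (φ.smoothAt_curve (hξ.comp_fst 0)
      (smoothAt_of_contDiff contDiff_snd _) rfl)).mul hh₁.inv) ?_
    simp [curve_zero]
  have hderiv := smoothAt_dirDeriv (g := fun y : V => (y, (0 : ℝ))) (h := fun _ => (0, 1)) hconj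
    (by fun_prop) (by fun_prop)
  simpa [dirDeriv, Ad] using hderiv

/-- The adjoint action of a group element, as a linear endomorphism of the Lie algebra. -/
noncomputable def adLinearMap (h : H) : E →ₗ[ℝ] E where
  toFun := φ.Ad h
  map_add' := φ.differential_add (φ.isOpen_translate h h⁻¹) (by simp [φ.one_mem])
    (φ.smoothOn_translate h h⁻¹)
  map_smul' := φ.differential_smul (φ.isOpen_translate h h⁻¹) (by simp [φ.one_mem])
    (φ.smoothOn_translate h h⁻¹)

theorem dSmooth_adLinearMap (h : H) : DSmooth (φ.adLinearMap h) := fun _ _ hp =>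
  smooth_iff_isPlot.1 <| smooth_of_forall_smoothAt fun x =>
    φ.smoothAt_Ad (smoothAt_const h x) ((smooth_iff_isPlot.2 hp).smoothAt x)

theorem Ad_add (h : H) (ξ η : E) : φ.Ad h (ξ + η) = φ.Ad h ξ + φ.Ad h η :=
  map_add (φ.adLinearMap h) ξ η

theorem Ad_sub (h : H) (ξ η : E) : φ.Ad h (ξ - η) = φ.Ad h ξ - φ.Ad h η :=
  map_sub (φ.adLinearMap h) ξ η

theorem Ad_smul (h : H) (a : ℝ) (ξ : E) : φ.Ad h (a • ξ) = a • φ.Ad h ξ :=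
  map_smul (φ.adLinearMap h) a ξ

theorem smoothOn_univ_Ad (η : E) : SmoothOn (fun g => φ.Ad g η) Set.univ := fun _ _ hp _ =>
  smooth_iff_isPlot.1 <| smooth_of_forall_smoothAt fun x =>
    φ.smoothAt_Ad ((smooth_iff_isPlot.2 hp).smoothAt x) (smoothAt_const η x)

omit [FiniteDimensional ℝ V] in
theorem dirDeriv_Ad_const {a : V → H} {x : V} (ha : SmoothAt a x) (hx : a x = 1) (η : E) (v : V) :
    dirDeriv (fun y => φ.Ad (a y) η) x v =
      φ.bracket (dirDeriv (fun y => φ.toFun (a y)) x v) η :=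
  φ.dirDeriv_comp_eq_differential (@isOpen_univ H dTopology) trivial (φ.smoothOn_univ_Ad η)
    ha hx v

end AdjointAction

section Bracket

variable [DiffeologicalGroup H] [ConvenientSpace E]
  {V : Type*} [NormedAddCommGroup V] [NormedSpace ℝ V] [FiniteDimensional ℝ V]

theorem bracket_add_left (ξ ξ' η : E) :
    φ.bracket (ξ + ξ') η = φ.bracket ξ η + φ.bracket ξ' η :=
  φ.differential_add (@isOpen_univ H dTopology) trivial (φ.smoothOn_univ_Ad η) ξ ξ'

theorem bracket_smul_left (a : ℝ) (ξ η : E) : φ.bracket (a • ξ) η = a • φ.bracket ξ η :=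
  φ.differential_smul (@isOpen_univ H dTopology) trivial (φ.smoothOn_univ_Ad η) a ξ

theorem bracket_neg_left (ξ η : E) : φ.bracket (-ξ) η = -φ.bracket ξ η :=
  φ.differential_neg (@isOpen_univ H dTopology) trivial (φ.smoothOn_univ_Ad η) ξ

theorem bracket_dirDeriv {k : V → H} {x : V} (hk : SmoothAt k x) (hkx : k x = 1) (v w : V) :
    φ.bracket (dirDeriv (fun y => φ.toFun (k y)) x v) (dirDeriv (fun y => φ.toFun (k y)) x w) =
      dirDeriv (fun y => dirDeriv (fun z => φ.toFun (k y * k z)) x w) x v -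
        dirDeriv (fun y => dirDeriv (fun z => φ.toFun (k y * k z)) x v) x w := by
  rw [← φ.dirDeriv_Ad_const hk hkx]
  simp only [← φ.dirDeriv_conj hk hkx]
  have hconj : SmoothAt (fun z : (V × V) × V => φ.toFun (k z.1.1 * k z.2 * (k z.1.2)⁻¹))
      ((x, x), x) :=
    φ.smoothAt_chart_of_eq_one ((((hk.comp_fst x).comp_fst x).mul (hk.comp_snd (x, x))).mul
      ((hk.comp_snd x).comp_fst x).inv) (by simp [hkx])
  have hconj' := (smoothAt_dirDeriv_snd
    (F := fun (p : V × V) z => φ.toFun (k p.1 * k z * (k p.2)⁻¹)) hconj w).comp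
      (x := (x, x)) (g := fun p : V × V => (p, x)) (by fun_prop)
  rw [dirDeriv_diag (f := fun y y' => dirDeriv (fun z => φ.toFun (k y * k z * (k y')⁻¹)) x w)
    hconj']
  simp only [hkx, inv_one, mul_one, one_mul]
  rw [sub_eq_add_neg]
  congr 1
  have hmul_inv : SmoothAt (fun z : V × V => φ.toFun (k z.2 * (k z.1)⁻¹)) (x, x) :=
    φ.smoothAt_chart_of_eq_one ((hk.comp_snd x).mul (hk.comp_fst x).inv) (by simp)
  rw [dirDeriv_partial_comm (F := fun y z => φ.toFun (k z * (k y)⁻¹)) hmul_inv]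
  have hneg : (fun z => dirDeriv (fun y => φ.toFun (k z * (k y)⁻¹)) x v) =ᶠ[𝓝 x]
      fun z => -dirDeriv (fun y => φ.toFun (k z * k y)) x v := by
    filter_upwards [hk.eventually_mem φ.open_source (hkx ▸ φ.one_mem)] with z hz
    exact φ.dirDeriv_chart_mul_inv hk hkx hz v
  rw [dirDeriv_congr hneg, dirDeriv_neg]
  exact (smoothAt_dirDeriv_snd (F := fun y z => φ.toFun (k y * k z))
    (φ.smoothAt_chart_mul hk hk (by simp [hkx])) v).comp (g := fun z : V => (z, x)) (by fun_prop)

theorem bracket_antisymm (ξ η : E) : φ.bracket ξ η = -φ.bracket η ξ := by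
  obtain ⟨k, hk, hk0, hkd⟩ := φ.exists_family_dirDeriv_eq ξ η
  have hξη := φ.bracket_dirDeriv hk hk0 (1, 0) (0, 1)
  have hηξ := φ.bracket_dirDeriv hk hk0 (0, 1) (1, 0)
  simp only [hkd, one_smul, zero_smul, add_zero, zero_add] at hξη hηξ
  rw [hξη, hηξ, neg_sub]

theorem bracket_add_right (ξ η η' : E) :
    φ.bracket ξ (η + η') = φ.bracket ξ η + φ.bracket ξ η' := by
  rw [bracket_antisymm, bracket_add_left, φ.bracket_antisymm η, φ.bracket_antisymm η']
  abel

theorem bracket_smul_right (a : ℝ) (ξ η : E) : φ.bracket ξ (a • η) = a • φ.bracket ξ η := by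
  rw [bracket_antisymm, bracket_smul_left, φ.bracket_antisymm η, smul_neg, neg_neg]

theorem bracket_zero_left (η : E) : φ.bracket 0 η = 0 := by
  simpa using φ.bracket_smul_left 0 0 η

theorem bracket_zero_right (ξ : E) : φ.bracket ξ 0 = 0 := by
  simpa using φ.bracket_smul_right 0 ξ 0

theorem smoothAt_bracket {ξ η : V → E} {x : V} (hξ : SmoothAt ξ x) (hη : SmoothAt η x) :
    SmoothAt (fun y => φ.bracket (ξ y) (η y)) x := by
  have hAd : SmoothAt (fun z : V × ℝ => φ.Ad (φ.curve (ξ z.1) z.2) (η z.1)) (x, 0) :=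
    φ.smoothAt_Ad (φ.smoothAt_curve (hξ.comp_fst 0) (smoothAt_of_contDiff contDiff_snd _) rfl)
      (hη.comp_fst 0)
  have hderiv := smoothAt_dirDeriv (g := fun y : V => (y, (0 : ℝ))) (h := fun _ => (0, 1)) hAd
    (by fun_prop) (by fun_prop)
  simpa [dirDeriv, bracket] using hderiv

/-- The Lie bracket as a bilinear map. -/
noncomputable def bracketLinearMap : E →ₗ[ℝ] E →ₗ[ℝ] E :=
  LinearMap.mk₂ ℝ φ.bracket φ.bracket_add_left φ.bracket_smul_left φ.bracket_add_right
    φ.bracket_smul_right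

theorem dirDeriv_bracket {ξ η : V → E} {x : V} (hξ : SmoothAt ξ x) (hη : SmoothAt η x) (v : V) :
    dirDeriv (fun y => φ.bracket (ξ y) (η y)) x v =
      φ.bracket (dirDeriv ξ x v) (η x) + φ.bracket (ξ x) (dirDeriv η x v) := by
  have hleft (η : E) : DSmooth (φ.bracketLinearMap.flip η) := fun _ _ hp =>
    smooth_iff_isPlot.1 <| smooth_of_forall_smoothAt fun x =>
      φ.smoothAt_bracket ((smooth_iff_isPlot.2 hp).smoothAt x) (smoothAt_const η x)
  have hright (ξ : E) : DSmooth (φ.bracketLinearMap ξ) := fun _ _ hp =>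
    smooth_iff_isPlot.1 <| smooth_of_forall_smoothAt fun x =>
      φ.smoothAt_bracket (smoothAt_const ξ x) ((smooth_iff_isPlot.2 hp).smoothAt x)
  rw [dirDeriv_diag (f := fun y z => φ.bracket (ξ y) (η z))
    (φ.smoothAt_bracket (hξ.comp_fst x) (hη.comp_snd x))]
  exact congrArg₂ _ (dirDeriv_map hξ (hleft _) v) (dirDeriv_map hη (hright _) v)

theorem Ad_bracket (h : H) (ξ η : E) :
    φ.Ad h (φ.bracket ξ η) = φ.bracket (φ.Ad h ξ) (φ.Ad h η) := by
  have hc := φ.smoothAt_curve_zero ξ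
  have hconj := ((smoothAt_const h 0).mul hc).mul (smoothAt_const h⁻¹ 0)
  calc φ.Ad h (φ.bracket ξ η)
      = φ.adLinearMap h (dirDeriv (fun t => φ.Ad (φ.curve ξ t) η) 0 1) := by
        rw [φ.dirDeriv_Ad_const hc (φ.curve_zero ξ), dirDeriv_curve]; rfl
    _ = dirDeriv (fun t => φ.Ad h (φ.Ad (φ.curve ξ t) η)) 0 1 :=
        (dirDeriv_map (φ.smoothAt_Ad hc (smoothAt_const η 0)) (φ.dSmooth_adLinearMap h) 1).symm
    _ = dirDeriv (fun t => φ.Ad (h * φ.curve ξ t * h⁻¹) (φ.Ad h η)) 0 1 := by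
        simp only [← Ad_mul, inv_mul_cancel_right]
    _ = φ.bracket (φ.Ad h ξ) (φ.Ad h η) := by
        rw [φ.dirDeriv_Ad_const hconj (by simp [curve_zero]),
          φ.dirDeriv_conj hc (φ.curve_zero ξ), dirDeriv_curve]

end Bracket

section LogDeriv

variable {m : ℕ}

theorem logDeriv_eq_dirDeriv (h : Euc m → H) (x v : Euc m) :
    φ.logDeriv h x v = dirDeriv (fun z => φ.toFun ((h x)⁻¹ * h z)) x v := rfl

theorem logDeriv_congr {h h' : Euc m → H} {x : Euc m} (heq : h =ᶠ[𝓝 x] h') (v : Euc m) :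
    φ.logDeriv h x v = φ.logDeriv h' x v := by
  rw [logDeriv_eq_dirDeriv, logDeriv_eq_dirDeriv, heq.self_of_nhds]
  exact dirDeriv_congr (heq.fun_comp fun g => φ.toFun ((h' x)⁻¹ * g)) v

theorem logDeriv_const_mul (g : H) (h : Euc m → H) (x v : Euc m) :
    φ.logDeriv (fun y => g * h y) x v = φ.logDeriv h x v := by
  simp [logDeriv, mul_assoc]

variable [DiffeologicalGroup H]

theorem smoothAt_chart_inv_mul_const {h : Euc m → H} {x : Euc m} (hh : SmoothAt h x) :
    SmoothAt (fun z => φ.toFun ((h x)⁻¹ * h z)) x :=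
  φ.smoothAt_chart_of_eq_one ((smoothAt_const _ x).mul hh) (by simp)

variable [ConvenientSpace E]

theorem smoothAt_logDeriv {h : Euc m → H} {x : Euc m} (hh : SmoothAt h x) (v : Euc m) :
    SmoothAt (fun y => φ.logDeriv h y v) x :=
  (smoothAt_dirDeriv_snd (F := fun y z => φ.toFun ((h y)⁻¹ * h z))
    (φ.smoothAt_chart_mul hh.inv hh (by simp)) v).comp (g := fun y : Euc m => (y, y)) (by fun_prop)

theorem logDeriv_add {h : Euc m → H} {x : Euc m} (hh : SmoothAt h x) (v w : Euc m) :
    φ.logDeriv h x (v + w) = φ.logDeriv h x v + φ.logDeriv h x w :=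
  dirDeriv_add_right (φ.smoothAt_chart_inv_mul_const hh) v w

theorem logDeriv_smul {h : Euc m → H} {x : Euc m} (hh : SmoothAt h x) (a : ℝ) (v : Euc m) :
    φ.logDeriv h x (a • v) = a • φ.logDeriv h x v :=
  dirDeriv_smul_right (φ.smoothAt_chart_inv_mul_const hh) a v

theorem logDeriv_comp {k : ℕ} {h : Euc m → H} {f : Euc k → Euc m} {x : Euc k}
    (hh : SmoothAt h (f x)) (hf : ContDiff ℝ ∞ f) (v : Euc k) :
    φ.logDeriv (fun y => h (f y)) x v = φ.logDeriv h (f x) (fderiv ℝ f x v) :=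
  dirDeriv_comp (φ.smoothAt_chart_inv_mul_const hh) hf v

theorem logDeriv_mul {g h : Euc m → H} {x : Euc m} (hg : SmoothAt g x) (hh : SmoothAt h x)
    (v : Euc m) : φ.logDeriv (fun y => g y * h y) x v =
      φ.Ad (h x)⁻¹ (φ.logDeriv g x v) + φ.logDeriv h x v := by
  have hg' := (smoothAt_const (g x)⁻¹ x).mul hg
  have hleibniz := φ.dirDeriv_chart_mul (x := x)
    (a := fun z => (h x)⁻¹ * ((g x)⁻¹ * g z) * ((h x)⁻¹)⁻¹) (b := fun z => (h x)⁻¹ * h z)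
    (((smoothAt_const _ x).mul hg').mul (smoothAt_const _ x))
    ((smoothAt_const _ x).mul hh) (by simp) (by simp) v
  rw [φ.dirDeriv_conj hg' (by simp)] at hleibniz
  simp only [logDeriv_eq_dirDeriv, ← hleibniz]
  simp only [inv_inv, mul_inv_rev, mul_assoc, mul_inv_cancel_left]

theorem dirDeriv_logDeriv_of_eq_one {k : Euc m → H} {x : Euc m} (hk : SmoothAt k x)
    (hkx : k x = 1) (v w : Euc m) :
    dirDeriv (fun y => φ.logDeriv k y w) x v =
      dirDeriv (fun y => dirDeriv (fun z => φ.toFun (k z)) y w) x v -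
        dirDeriv (fun y => dirDeriv (fun z => φ.toFun (k y * k z)) x w) x v := by
  have hinv_mul := φ.smoothAt_chart_mul hk.inv hk (by simp)
  have hmul := φ.smoothAt_chart_mul hk hk (by simp [hkx])
  have hdiag := dirDeriv_diag (f := fun y y' => dirDeriv (fun z => φ.toFun ((k y)⁻¹ * k z)) y' w)
    (smoothAt_dirDeriv_snd (F := fun y z => φ.toFun ((k y)⁻¹ * k z)) hinv_mul w) v
  refine hdiag.trans ?_
  rw [add_comm, sub_eq_add_neg]
  refine congrArg₂ _ (by simp [hkx]) ?_
  rw [dirDeriv_partial_comm (F := fun y z => φ.toFun ((k y)⁻¹ * k z)) hinv_mul,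
    dirDeriv_partial_comm (F := fun y z => φ.toFun (k y * k z)) hmul]
  have hneg : (fun z => dirDeriv (fun y => φ.toFun ((k y)⁻¹ * k z)) x v) =ᶠ[𝓝 x]
      fun z => -dirDeriv (fun y => φ.toFun (k y * k z)) x v := by
    filter_upwards [hk.eventually_mem φ.open_source (hkx ▸ φ.one_mem)] with z hz
    exact φ.dirDeriv_chart_inv_mul hk hkx hz v
  rw [dirDeriv_congr hneg, dirDeriv_neg]
  exact (smoothAt_dirDeriv_fst (F := fun y z => φ.toFun (k y * k z)) hmul v).comp
    (g := fun z : Euc m => (x, z)) (by fun_prop)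

theorem maurerCartan {h : Euc m → H} {x : Euc m} (hh : SmoothAt h x) (v w : Euc m) :
    dirDeriv (fun y => φ.logDeriv h y w) x v - dirDeriv (fun y => φ.logDeriv h y v) x w +
      φ.bracket (φ.logDeriv h x v) (φ.logDeriv h x w) = 0 := by
  let k : Euc m → H := fun y => (h x)⁻¹ * h y
  have hk : SmoothAt k x := (smoothAt_const _ x).mul hh
  have hkx : k x = 1 := by simp [k]
  have hhk (y v : Euc m) : φ.logDeriv h y v = φ.logDeriv k y v :=
    (φ.logDeriv_const_mul _ h y v).symm
  have hkθ (v : Euc m) : φ.logDeriv k x v = dirDeriv (fun y => φ.toFun (k y)) x v := by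
    simp [logDeriv_eq_dirDeriv, hkx]
  simp only [hhk]
  rw [hkθ, hkθ, φ.bracket_dirDeriv hk hkx, φ.dirDeriv_logDeriv_of_eq_one hk hkx v w,
    φ.dirDeriv_logDeriv_of_eq_one hk hkx w v,
    dirDeriv_dirDeriv_comm (φ.smoothAt_chart_of_eq_one hk hkx) v w]
  abel

theorem dirDeriv_Ad_inv {h : Euc m → H} {ξ : Euc m → E} {x : Euc m} (hh : SmoothAt h x)
    (hξ : SmoothAt ξ x) (v : Euc m) : dirDeriv (fun y => φ.Ad (h y)⁻¹ (ξ y)) x v =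
      φ.Ad (h x)⁻¹ (dirDeriv ξ x v) - φ.bracket (φ.logDeriv h x v) (φ.Ad (h x)⁻¹ (ξ x)) := by
  have hAd : SmoothAt (fun z : Euc m × Euc m => φ.Ad (h z.1)⁻¹ (ξ z.2)) (x, x) :=
    φ.smoothAt_Ad (hh.comp_fst x).inv (hξ.comp_snd x)
  rw [dirDeriv_diag (f := fun y z => φ.Ad (h y)⁻¹ (ξ z)) hAd, add_comm, sub_eq_add_neg]
  refine congrArg₂ _ (dirDeriv_map hξ (φ.dSmooth_adLinearMap (h x)⁻¹) v) ?_
  have hk : SmoothAt (fun y => (h x)⁻¹ * h y) x := (smoothAt_const _ x).mul hh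
  have hbracket := φ.dirDeriv_Ad_const hk.inv (by simp) (φ.Ad (h x)⁻¹ (ξ x)) v
  rw [φ.dirDeriv_chart_inv hk (by simp), bracket_neg_left] at hbracket
  simpa [← Ad_mul, ← logDeriv_eq_dirDeriv] using hbracket

end LogDeriv

section Curvature

variable {m : ℕ}

theorem curvature_eq_dirDeriv (A : Euc m → Euc m → E) (x v w : Euc m) :
    φ.curvature A x v w =
      dirDeriv (fun y => A y w) x v - dirDeriv (fun y => A y v) x w + φ.bracket (A x v) (A x w) :=
  rfl

theorem curvature_congr {A B : Euc m → Euc m → E} {x : Euc m} (h : A =ᶠ[𝓝 x] B) :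
    φ.curvature A x = φ.curvature B x := by
  funext v w
  have happly (w : Euc m) : (fun y => A y w) =ᶠ[𝓝 x] fun y => B y w :=
    h.mono fun y hy => congrFun hy w
  rw [curvature_eq_dirDeriv, curvature_eq_dirDeriv, dirDeriv_congr (happly w),
    dirDeriv_congr (happly v), h.self_of_nhds]

theorem curvature_gauge [DiffeologicalGroup H] [ConvenientSpace E] {A : Euc m → Euc m → E}
    {h : Euc m → H} {x : Euc m}
    (hA : ∀ v, SmoothAt (fun y => A y v) x) (hh : SmoothAt h x) (v w : Euc m) :
    φ.curvature (fun y v => φ.Ad (h y)⁻¹ (A y v) + φ.logDeriv h y v) x v w =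
      φ.Ad (h x)⁻¹ (φ.curvature A x v w) := by
  have hderiv (v w : Euc m) : dirDeriv (fun y => φ.Ad (h y)⁻¹ (A y w) + φ.logDeriv h y w) x v =
      φ.Ad (h x)⁻¹ (dirDeriv (fun y => A y w) x v) -
        φ.bracket (φ.logDeriv h x v) (φ.Ad (h x)⁻¹ (A x w)) +
        dirDeriv (fun y => φ.logDeriv h y w) x v := by
    rw [dirDeriv_add (φ.smoothAt_Ad hh.inv (hA w)) (φ.smoothAt_logDeriv hh w),
      φ.dirDeriv_Ad_inv hh (hA w)]
  rw [curvature_eq_dirDeriv, curvature_eq_dirDeriv, hderiv, hderiv, Ad_add, Ad_sub, Ad_bracket,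
    bracket_add_left, bracket_add_right, bracket_add_right,
    φ.bracket_antisymm (φ.Ad (h x)⁻¹ (A x v)) (φ.logDeriv h x w), ← sub_eq_zero,
    ← φ.maurerCartan hh v w]
  abel

end Curvature

end LieChart

/-! ### The algebra of polynomial forms -/

section AlternatingSmooth

variable {V W : Type*} [NormedAddCommGroup V] [NormedSpace ℝ V] [FiniteDimensional ℝ V]
  [NormedAddCommGroup W] [NormedSpace ℝ W]

theorem contDiff_continuousAlternatingMap_of_apply {n : ℕ} {α : W → V [⋀^Fin n]→L[ℝ] ℝ}
    (h : ∀ v, ContDiff ℝ ∞ fun x => α x v) : ContDiff ℝ ∞ α := by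
  let b := Module.finBasis ℝ V
  let evalBasis : (V [⋀^Fin n]→L[ℝ] ℝ) →ₗ[ℝ] ((Fin n → Fin (Module.finrank ℝ V)) → ℝ) :=
    { toFun := fun β f => β fun i => b (f i)
      map_add' := fun _ _ => rfl
      map_smul' := fun _ _ => rfl }
  have hker : LinearMap.ker evalBasis = ⊥ := by
    refine LinearMap.ker_eq_bot'.2 fun β hβ => ?_
    have hzero : β.toAlternatingMap = 0 := Module.Basis.ext_alternating b fun f _ => congrFun hβ f
    exact ContinuousAlternatingMap.ext fun v => congrArg (fun β => β v) hzero
  obtain ⟨S, hS⟩ := evalBasis.exists_leftInverse_of_injective hker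
  have heval : ContDiff ℝ ∞ fun x => evalBasis (α x) := contDiff_pi.2 fun f => h fun i => b (f i)
  have hα : α = fun x => S (evalBasis (α x)) :=
    funext fun x => (LinearMap.congr_fun hS (α x)).symm
  rw [hα]
  exact (LinearMap.toContinuousLinearMap S).contDiff.comp heval

end AlternatingSmooth

section Permutations

/-- The permutations of `Fin (n + 1)` sending `0` to `i` are given by the permutations of the
remaining `n` elements. -/
def insertPerm {n : ℕ} (z : Fin (n + 1) × Equiv.Perm (Fin n)) : Equiv.Perm (Fin (n + 1)) :=
  (Fin.cycleRange z.1).symm * Equiv.Perm.decomposeFin.symm (0, z.2)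

theorem insertPerm_zero {n : ℕ} (z : Fin (n + 1) × Equiv.Perm (Fin n)) :
    insertPerm z 0 = z.1 := by
  simp [insertPerm]

theorem insertPerm_succ {n : ℕ} (z : Fin (n + 1) × Equiv.Perm (Fin n)) (j : Fin n) :
    insertPerm z j.succ = z.1.succAbove (z.2 j) := by
  simp [insertPerm]

theorem sign_insertPerm {n : ℕ} (z : Fin (n + 1) × Equiv.Perm (Fin n)) :
    ((Equiv.Perm.sign (insertPerm z) : ℤ) : ℝ) =
      (-1 : ℝ) ^ (z.1 : ℕ) * ((Equiv.Perm.sign z.2 : ℤ) : ℝ) := by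
  simp [insertPerm, Equiv.Perm.sign_mul, Equiv.Perm.sign_symm, Fin.sign_cycleRange,
    Equiv.Perm.decomposeFin.symm_sign]

theorem bijective_insertPerm (n : ℕ) : Function.Bijective (insertPerm (n := n)) := by
  refine (Fintype.bijective_iff_injective_and_card _).2 ⟨fun z z' h => ?_, ?_⟩
  · have hfst : z.1 = z'.1 := by rw [← insertPerm_zero z, h, insertPerm_zero]
    refine Prod.ext hfst (Equiv.ext fun j => ?_)
    have hsucc := insertPerm_succ z j
    rw [h, insertPerm_succ z' j, hfst] at hsucc
    exact (Fin.succAbove_right_injective hsucc).symm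
  · rw [Fintype.card_prod, Fintype.card_perm, Fintype.card_perm, Fintype.card_fin,
      Fintype.card_fin, Nat.factorial_succ]

theorem sum_removeNth_perm {V : Type*} {n : ℕ} (G : (Fin (n + 1) → V) → ℝ) (v : Fin (n + 1) → V) :
    ∑ i : Fin (n + 1), (-1 : ℝ) ^ (i : ℕ) * ∑ τ : Equiv.Perm (Fin n),
      ((Equiv.Perm.sign τ : ℤ) : ℝ) * G (Fin.cons (v i) fun j => i.removeNth v (τ j)) =
    ∑ ρ : Equiv.Perm (Fin (n + 1)), ((Equiv.Perm.sign ρ : ℤ) : ℝ) * G fun j => v (ρ j) := by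
  have hv (z : Fin (n + 1) × Equiv.Perm (Fin n)) : (fun j => v (insertPerm z j)) =
      Fin.cons (v z.1) fun j => z.1.removeNth v (z.2 j) := by
    funext j
    cases j using Fin.cases with
    | zero => rw [insertPerm_zero]; rfl
    | succ j => rw [insertPerm_succ]; rfl
  rw [← (bijective_insertPerm n).sum_comp, Fintype.sum_prod_type]
  simp only [Finset.mul_sum, sign_insertPerm, hv, mul_assoc]

theorem sum_perm_cyclic_eq_zero {V : Type*} {n : ℕ} {G : (Fin n → V) → ℝ} {a b c : Fin n}
    (hab : a ≠ b) (hbc : b ≠ c)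
    (hG : ∀ w : Fin n → V, G w +
      G (fun j => w ((Equiv.swap a b * Equiv.swap b c) j)) +
      G (fun j => w ((Equiv.swap a b * Equiv.swap b c) ((Equiv.swap a b * Equiv.swap b c) j))) = 0)
    (v : Fin n → V) :
    ∑ ρ : Equiv.Perm (Fin n), ((Equiv.Perm.sign ρ : ℤ) : ℝ) * G (fun j => v (ρ j)) = 0 := by
  set s := Equiv.swap a b * Equiv.swap b c with hs
  have hsign : Equiv.Perm.sign s = 1 := by
    rw [hs, Equiv.Perm.sign_mul, Equiv.Perm.sign_swap hab, Equiv.Perm.sign_swap hbc]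
    rfl
  set S := fun ρ : Equiv.Perm (Fin n) => ((Equiv.Perm.sign ρ : ℤ) : ℝ) * G (fun j => v (ρ j))
  have hshift : ∑ ρ, S (ρ * s) = ∑ ρ, S ρ := Equiv.sum_comp (Equiv.mulRight s) S
  have hshift' : ∑ ρ, S (ρ * s * s) = ∑ ρ, S (ρ * s) :=
    Equiv.sum_comp (Equiv.mulRight s) fun ρ => S (ρ * s)
  have hcyclic : ∑ ρ, (S ρ + S (ρ * s) + S (ρ * s * s)) = 0 := by
    refine Finset.sum_eq_zero fun ρ _ => ?_
    simp only [S, Equiv.Perm.sign_mul, hsign, mul_one, ← mul_add]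
    exact mul_eq_zero_of_right _ (hG fun j => v (ρ j))
  rw [Finset.sum_add_distrib, Finset.sum_add_distrib, hshift', hshift] at hcyclic
  linarith

end Permutations

section PolyForm

/-- The first of the two slots of a `2r`-form `P(F,…,F)` that belong to the `j`-th factor `F`. -/
abbrev fstSlot {r : ℕ} (j : Fin r) : Fin (2 * r) := ⟨2 * (j : ℕ), by omega⟩

/-- The second of the two slots of a `2r`-form `P(F,…,F)` that belong to the `j`-th factor `F`. -/
abbrev sndSlot {r : ℕ} (j : Fin r) : Fin (2 * r) := ⟨2 * (j : ℕ) + 1, by omega⟩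

section Bianchi

variable {V E : Type*} [AddCommGroup E] [Module ℝ E] {r : ℕ}
  (P : MultilinearMap ℝ (fun _ : Fin r => E) ℝ) (F : V → V → E) (T : V → V → V → E)

/-- `P(F,…,T,…,F)` before antisymmetrisation, where `T`, standing for the derivative of `F`,
replaces the factor `j₀` and takes the vector with index `0` as its first argument. -/
def polyDerivTerm (j₀ : Fin r) (w : Fin (2 * r + 1) → V) : ℝ :=
  P (Function.update (fun j => F (w (fstSlot j).succ) (w (sndSlot j).succ)) j₀
    (T (w 0) (w (fstSlot j₀).succ) (w (sndSlot j₀).succ)))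

variable {F T}

theorem polyDerivTerm_cyclic (hT : ∀ u v w, T u v w + T v w u + T w u v = 0) (j₀ : Fin r)
    {s : Equiv.Perm (Fin (2 * r + 1))} (hzero : s 0 = (fstSlot j₀).succ)
    (hfst : s (fstSlot j₀).succ = (sndSlot j₀).succ) (hsnd : s (sndSlot j₀).succ = 0)
    (hs : ∀ c, c ≠ 0 → c ≠ (fstSlot j₀).succ → c ≠ (sndSlot j₀).succ → s c = c)
    (w : Fin (2 * r + 1) → V) :
    polyDerivTerm P F T j₀ w + polyDerivTerm P F T j₀ (fun j => w (s j)) +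
      polyDerivTerm P F T j₀ (fun j => w (s (s j))) = 0 := by
  have hother (w : Fin (2 * r + 1) → V) (ξ : E) : Function.update
      (fun j => F (w (s (fstSlot j).succ)) (w (s (sndSlot j).succ))) j₀ ξ =
      Function.update (fun j => F (w (fstSlot j).succ) (w (sndSlot j).succ)) j₀ ξ := by
    funext j
    by_cases hj : j = j₀
    · subst hj; simp
    · have hj' : (j : ℕ) ≠ j₀ := fun h => hj (Fin.ext h)
      rw [Function.update_of_ne hj, Function.update_of_ne hj, hs, hs]
      all_goals simp [Fin.ext_iff]
      all_goals omega
  simp only [polyDerivTerm]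
  rw [hother (fun j => w (s j)), hother w, hother w]
  simp only [hzero, hfst, hsnd]
  rw [← P.map_update_add, ← P.map_update_add, hT, P.map_update_zero]

theorem sum_perm_polyDerivTerm_eq_zero (hT : ∀ u v w, T u v w + T v w u + T w u v = 0)
    (j₀ : Fin r) (v : Fin (2 * r + 1) → V) :
    ∑ ρ : Equiv.Perm (Fin (2 * r + 1)),
      ((Equiv.Perm.sign ρ : ℤ) : ℝ) * polyDerivTerm P F T j₀ (fun j => v (ρ j)) = 0 := by
  have hfst : (0 : Fin (2 * r + 1)) ≠ (fstSlot j₀).succ := (Fin.succ_ne_zero _).symm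
  have hsnd : (0 : Fin (2 * r + 1)) ≠ (sndSlot j₀).succ := (Fin.succ_ne_zero _).symm
  have hne : (fstSlot j₀).succ ≠ (sndSlot j₀).succ := by simp [Fin.ext_iff]
  refine sum_perm_cyclic_eq_zero hfst hne (polyDerivTerm_cyclic P hT j₀ ?_ ?_ ?_ ?_) v
  · rw [Equiv.Perm.mul_apply, Equiv.swap_apply_of_ne_of_ne hfst hsnd, Equiv.swap_apply_left]
  · rw [Equiv.Perm.mul_apply, Equiv.swap_apply_left,
      Equiv.swap_apply_of_ne_of_ne hsnd.symm hne.symm]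
  · rw [Equiv.Perm.mul_apply, Equiv.swap_apply_right, Equiv.swap_apply_right]
  · intro c hzero hfst_ne hsnd_ne
    rw [Equiv.Perm.mul_apply, Equiv.swap_apply_of_ne_of_ne hfst_ne hsnd_ne,
      Equiv.swap_apply_of_ne_of_ne hzero hfst_ne]

theorem sum_polyForm_deriv_eq_zero (hT : ∀ u v w, T u v w + T v w u + T w u v = 0)
    (v : Fin (2 * r + 1) → V) :
    ∑ i : Fin (2 * r + 1), (-1 : ℝ) ^ (i : ℕ) * ((1 / 2 : ℝ) ^ r *
      ∑ τ : Equiv.Perm (Fin (2 * r)), ((Equiv.Perm.sign τ : ℤ) : ℝ) * ∑ j₀ : Fin r,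
        P (Function.update
          (fun j => F (i.removeNth v (τ (fstSlot j))) (i.removeNth v (τ (sndSlot j)))) j₀
          (T (v i) (i.removeNth v (τ (fstSlot j₀))) (i.removeNth v (τ (sndSlot j₀)))))) = 0 := by
  have hsum : ∑ j₀ : Fin r, ∑ i : Fin (2 * r + 1), (-1 : ℝ) ^ (i : ℕ) *
      ∑ τ : Equiv.Perm (Fin (2 * r)), ((Equiv.Perm.sign τ : ℤ) : ℝ) *
        polyDerivTerm P F T j₀ (Fin.cons (v i) fun j => i.removeNth v (τ j)) = 0 :=
    Finset.sum_eq_zero fun j₀ _ => (sum_removeNth_perm (polyDerivTerm P F T j₀) v).trans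
      (sum_perm_polyDerivTerm_eq_zero P hT j₀ v)
  rw [Finset.sum_comm] at hsum
  rw [← mul_zero ((1 / 2 : ℝ) ^ r), ← hsum, Finset.mul_sum]
  refine Finset.sum_congr rfl fun i _ => ?_
  rw [← Finset.mul_sum, Finset.sum_comm, mul_left_comm]
  simp only [Finset.mul_sum]
  rfl

end Bianchi

section Alternatization

variable {V E : Type*} {r : ℕ}

theorem exists_pairing_update_eq (F : V → V → E) (v : Fin (2 * r) → V) (i : Fin (2 * r)) :
    ∃ (j₀ : Fin r) (L : V → E), (∀ x, (fun j =>
      F (Function.update v i x (fstSlot j)) (Function.update v i x (sndSlot j))) =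
        Function.update (fun j => F (v (fstSlot j)) (v (sndSlot j))) j₀ (L x)) ∧
      (L = (fun x => F x (v (sndSlot j₀))) ∨ L = F (v (fstSlot j₀))) := by
  obtain ⟨i, hi⟩ := i
  rcases Nat.even_or_odd' i with ⟨k, rfl | rfl⟩
  · refine ⟨⟨k, by omega⟩, fun x => F x (v ⟨2 * k + 1, by omega⟩), fun x => ?_, Or.inl rfl⟩
    funext j
    by_cases hj : (j : ℕ) = k
    · subst hj
      simp [Function.update_of_ne, Fin.ext_iff]
    · rw [Function.update_of_ne, Function.update_of_ne, Function.update_of_ne]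
      all_goals simp [Fin.ext_iff]
      all_goals omega
  · refine ⟨⟨k, by omega⟩, F (v ⟨2 * k, by omega⟩), fun x => ?_, Or.inr rfl⟩
    funext j
    by_cases hj : (j : ℕ) = k
    · subst hj
      simp [Function.update_of_ne, Fin.ext_iff]
    · rw [Function.update_of_ne, Function.update_of_ne, Function.update_of_ne]
      all_goals simp [Fin.ext_iff]
      all_goals omega

variable [AddCommGroup V] [Module ℝ V] [AddCommGroup E] [Module ℝ E]
  (P : MultilinearMap ℝ (fun _ : Fin r => E) ℝ)

/-- `P(F,…,F)` before antisymmetrisation. -/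
def polyMultilinear (F : V → V → E) (hleft : ∀ w, IsLinearMap ℝ fun v => F v w)
    (hright : ∀ v, IsLinearMap ℝ (F v)) : MultilinearMap ℝ (fun _ : Fin (2 * r) => V) ℝ where
  toFun v := P fun j => F (v (fstSlot j)) (v (sndSlot j))
  map_update_add' v i x y := by
    rename_i inst
    rw [Subsingleton.elim inst (instDecidableEqFin _)]
    obtain ⟨j₀, L, hL, h⟩ := exists_pairing_update_eq F v i
    have hadd : L (x + y) = L x + L y := by
      rcases h with rfl | rfl
      · exact (hleft _).map_add x y
      · exact (hright _).map_add x y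
    rw [hL, hL, hL, hadd, P.map_update_add]
  map_update_smul' v i c x := by
    rename_i inst
    rw [Subsingleton.elim inst (instDecidableEqFin _)]
    obtain ⟨j₀, L, hL, h⟩ := exists_pairing_update_eq F v i
    have hsmul : L (c • x) = c • L x := by
      rcases h with rfl | rfl
      · exact (hleft _).map_smul c x
      · exact (hright _).map_smul c x
    rw [hL, hL, hsmul, P.map_update_smul]

theorem polyForm_eq_alternatization (F : V → V → E) (hleft : ∀ w, IsLinearMap ℝ fun v => F v w)
    (hright : ∀ v, IsLinearMap ℝ (F v)) (v : Fin (2 * r) → V) :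
    polyForm P F v = ((1 / 2 : ℝ) ^ r •
      MultilinearMap.alternatization (polyMultilinear P F hleft hright)) v := by
  rw [polyForm, AlternatingMap.smul_apply, MultilinearMap.alternatization_apply, smul_eq_mul]
  congr 1
  refine Finset.sum_congr rfl fun τ _ => ?_
  rw [Units.smul_def, zsmul_eq_mul]
  rfl

end Alternatization

end PolyForm

/-! ### Curvature and invariant polynomials -/

section OneForms

theorem contDiff_fderiv_apply {V W : Type*} [NormedAddCommGroup V] [NormedSpace ℝ V]
    [NormedAddCommGroup W] [NormedSpace ℝ W] {f : W → V} (hf : ContDiff ℝ ∞ f) (w : W) :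
    ContDiff ℝ ∞ fun x => fderiv ℝ f x w :=
  (hf.fderiv_right (m := ∞) (by simp)).clm_apply contDiff_const

variable {V W E : Type*} [NormedAddCommGroup V] [NormedSpace ℝ V] [FiniteDimensional ℝ V]
  [NormedAddCommGroup W] [NormedSpace ℝ W] [FiniteDimensional ℝ W]
  [AddCommGroup E] [Module ℝ E] [DiffeologicalSpace E]

/-- Smooth `1`-forms on a normed space with values in a convenient vector space. -/
structure IsOneForm (A : V → V → E) : Prop where
  linear : ∀ x, IsLinearMap ℝ (A x)
  smooth : ∀ v, Smooth fun x => A x v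

section

variable [ConvenientSpace E]

theorem smooth_uncurry {A : W → V → E} (hlin : ∀ x, IsLinearMap ℝ (A x))
    (hA : ∀ v, Smooth fun x => A x v) : Smooth fun z : W × V => A z.1 z.2 := by
  let b := Module.finBasis ℝ V
  have hbasis : (fun z : W × V => A z.1 z.2) = fun z => ∑ i, b.coord i z.2 • A z.1 (b i) := by
    funext z
    have hrepr := congrArg (hlin z.1).mk' (b.sum_repr z.2)
    simp only [map_sum, map_smul] at hrepr
    exact hrepr.symm
  rw [hbasis]
  refine smooth_of_forall_smoothAt fun z => SmoothAt.sum _ fun i _ => SmoothAt.smul ?_ ?_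
  · exact smoothAt_of_contDiff
      ((LinearMap.toContinuousLinearMap (b.coord i)).contDiff.comp contDiff_snd) z
  · exact ((hA (b i)).comp contDiff_fst).smoothAt z

theorem smooth_of_isLinearMap {L : V → E} (hL : IsLinearMap ℝ L) : Smooth L :=
  (smooth_uncurry (W := V) (A := fun _ => L) (fun _ => hL) fun _ => smooth_const _).comp
    (g := fun v => (v, v)) (by fun_prop)

omit [FiniteDimensional ℝ V] in
theorem dirDeriv_of_isLinearMap {L : V → E} (hL : IsLinearMap ℝ L) (x v : V) :
    dirDeriv L x v = L v := by
  refine dirDeriv_eq_of_forall_functional fun ℓ _ => ?_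
  have hline : (fun t : ℝ => ℓ (L (x + t • v))) = fun t => ℓ (L x) + t * ℓ (L v) := by
    funext t
    rw [hL.map_add, hL.map_smul, map_add, map_smul, smul_eq_mul]
  rw [hline]
  simpa using ((hasDerivAt_id (0 : ℝ)).mul_const (ℓ (L v))).const_add (ℓ (L x))

omit [FiniteDimensional ℝ W] in
theorem IsOneForm.smooth_apply {A : V → V → E} (hA : IsOneForm A) {f g : W → V}
    (hf : ContDiff ℝ ∞ f) (hg : ContDiff ℝ ∞ g) : Smooth fun x => A (f x) (g x) :=
  (smooth_uncurry hA.linear hA.smooth).comp (hf.prodMk hg)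

theorem dirDeriv_pullback {A : V → V → E} (hA : IsOneForm A) {f : W → V} (hf : ContDiff ℝ ∞ f)
    (x v w : W) : dirDeriv (fun y => A (f y) (fderiv ℝ f y w)) x v =
      dirDeriv (fun y => A y (fderiv ℝ f x w)) (f x) (fderiv ℝ f x v) +
        A (f x) (fderiv ℝ (fderiv ℝ f) x v w) := by
  have hsplit : Smooth fun z : W × W => A (f z.1) (fderiv ℝ f z.2 w) :=
    hA.smooth_apply (hf.comp contDiff_fst) ((contDiff_fderiv_apply hf w).comp contDiff_snd)
  rw [dirDeriv_diag (f := fun y z => A (f y) (fderiv ℝ f z w)) (hsplit.smoothAt _)]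
  refine congrArg₂ _ (dirDeriv_comp ((hA.smooth _).smoothAt _) hf v) ?_
  rw [dirDeriv_comp (f := A (f x)) (g := fun y => fderiv ℝ f y w)
    ((smooth_of_isLinearMap (hA.linear _)).smoothAt _) (contDiff_fderiv_apply hf w),
    dirDeriv_of_isLinearMap (hA.linear _)]
  have hd : DifferentiableAt ℝ (fderiv ℝ f) x :=
    (hf.fderiv_right (m := ∞) (by simp)).differentiable (by simp) x
  rw [fderiv_clm_apply hd (by fun_prop)]
  simp

end

variable {H : Type*} [Group H] [DiffeologicalSpace H] [ConvenientSpace E] (φ : LieChart H E) {m : ℕ}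

namespace LieChart

theorem curvature_pullback {k : ℕ} {A : Euc m → Euc m → E} (hA : IsOneForm A)
    {f : Euc k → Euc m} (hf : ContDiff ℝ ∞ f) (x v w : Euc k) :
    φ.curvature (fun y u => A (f y) (fderiv ℝ f y u)) x v w =
      φ.curvature A (f x) (fderiv ℝ f x v) (fderiv ℝ f x w) := by
  have hsymm : fderiv ℝ (fderiv ℝ f) x v w = fderiv ℝ (fderiv ℝ f) x w v :=
    (hf.contDiffAt (x := x)).isSymmSndFDerivAt (by
      rw [minSmoothness_of_isRCLikeNormedField]
      exact WithTop.coe_le_coe.2 (le_top (a := (2 : ℕ∞)))) v w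
  rw [curvature_eq_dirDeriv, curvature_eq_dirDeriv, dirDeriv_pullback hA hf,
    dirDeriv_pullback hA hf, hsymm]
  abel

variable [DiffeologicalGroup H]

theorem curvature_antisymm (A : Euc m → Euc m → E) (x v w : Euc m) :
    φ.curvature A x v w = -φ.curvature A x w v := by
  rw [curvature, curvature, φ.bracket_antisymm (A x v)]
  abel

variable {A : Euc m → Euc m → E} (hA : IsOneForm A)

include hA

theorem smooth_curvature (v w : Euc m) : Smooth fun x => φ.curvature A x v w :=
  smooth_of_forall_smoothAt fun x => SmoothAt.add
    (SmoothAt.sub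
      (smoothAt_dirDeriv (g := id) ((hA.smooth w).smoothAt x) contDiff_id contDiff_const)
      (smoothAt_dirDeriv (g := id) ((hA.smooth v).smoothAt x) contDiff_id contDiff_const))
    (φ.smoothAt_bracket ((hA.smooth v).smoothAt x) ((hA.smooth w).smoothAt x))

theorem isLinearMap_curvature_left (x w : Euc m) :
    IsLinearMap ℝ fun v => φ.curvature A x v w := by
  constructor
  · intro v v'
    simp only [curvature_eq_dirDeriv, (hA.linear _).map_add,
      dirDeriv_add_right ((hA.smooth w).smoothAt x),
      dirDeriv_add ((hA.smooth v).smoothAt x) ((hA.smooth v').smoothAt x), bracket_add_left]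
    abel
  · intro c v
    simp only [curvature_eq_dirDeriv, (hA.linear _).map_smul,
      dirDeriv_smul_right ((hA.smooth w).smoothAt x),
      dirDeriv_const_smul ((hA.smooth v).smoothAt x), bracket_smul_left, smul_add, smul_sub]

theorem isLinearMap_curvature_right (x v : Euc m) : IsLinearMap ℝ (φ.curvature A x v) := by
  have hswap : φ.curvature A x v = fun w => -φ.curvature A x w v :=
    funext fun w => φ.curvature_antisymm A x v w
  rw [hswap]
  exact (-(φ.isLinearMap_curvature_left hA x v).mk' _).isLinear

theorem bianchi_of_eq_zero {x : Euc m} (hx : A x = 0) (u v w : Euc m) :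
    dirDeriv (fun y => φ.curvature A y v w) x u + dirDeriv (fun y => φ.curvature A y w u) x v +
      dirDeriv (fun y => φ.curvature A y u v) x w = 0 := by
  have hsmooth (v : Euc m) := (hA.smooth v).smoothAt x
  have hsmooth' (v w : Euc m) : SmoothAt (fun y => dirDeriv (fun z => A z w) y v) x :=
    smoothAt_dirDeriv (g := id) (hsmooth w) contDiff_id contDiff_const
  have hderiv (u v w : Euc m) : dirDeriv (fun y => φ.curvature A y v w) x u =
      dirDeriv (fun y => dirDeriv (fun z => A z w) y v) x u -
        dirDeriv (fun y => dirDeriv (fun z => A z v) y w) x u := by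
    refine (dirDeriv_add ((hsmooth' v w).sub (hsmooth' w v))
      (φ.smoothAt_bracket (hsmooth v) (hsmooth w)) u).trans ?_
    rw [dirDeriv_sub (hsmooth' v w) (hsmooth' w v), φ.dirDeriv_bracket (hsmooth v) (hsmooth w), hx]
    simp [bracket_zero_left, bracket_zero_right]
  rw [hderiv, hderiv, hderiv, dirDeriv_dirDeriv_comm (hsmooth w) u v,
    dirDeriv_dirDeriv_comm (hsmooth v) w u, dirDeriv_dirDeriv_comm (hsmooth u) v w]
  abel

end LieChart

end OneForms

section InvariantPolynomials

theorem fderiv_diag_eq_sum {V : Type*} [NormedAddCommGroup V] [NormedSpace ℝ V] {ι : Type*}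
    [Fintype ι] [DecidableEq ι] {g : (ι → V) → ℝ} {x : V}
    (hg : DifferentiableAt ℝ g fun _ => x) (v : V) :
    fderiv ℝ (fun y => g fun _ => y) x v =
      ∑ i, fderiv ℝ (fun y => g (Function.update (fun _ => x) i y)) x v := by
  have hdiag : HasFDerivAt (fun y => g fun _ => y)
      ((fderiv ℝ g fun _ => x).comp (ContinuousLinearMap.pi fun _ => .id ℝ V)) x :=
    HasFDerivAt.comp x (g := g) (f := fun y _ => y) hg.hasFDerivAt
      (hasFDerivAt_pi.2 fun _ => hasFDerivAt_id x)
  have hpartial (i : ι) : HasFDerivAt (fun y => g (Function.update (fun _ => x) i y))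
      ((fderiv ℝ g fun _ => x).comp (ContinuousLinearMap.pi (Pi.single i (.id ℝ V)))) x :=
    HasFDerivAt.comp x (g := g) (by simpa using hg.hasFDerivAt)
      (hasFDerivAt_update (fun _ : ι => x) x)
  have hsum : (fun _ => v) = ∑ i, (Pi.single i v : ι → V) :=
    (Finset.univ_sum_single fun _ => v).symm
  have hsingle (i : ι) :
      ContinuousLinearMap.pi (Pi.single i (.id ℝ V)) v = (Pi.single i v : ι → V) := by
    funext j
    rcases eq_or_ne j i with rfl | hj <;> simp [*]
  simp only [hdiag.fderiv, (hpartial _).fderiv, ContinuousLinearMap.comp_apply, hsingle]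
  rw [← map_sum, ← hsum]
  rfl

variable {V E H : Type*} [NormedAddCommGroup V] [NormedSpace ℝ V] [FiniteDimensional ℝ V]
  [AddCommGroup E] [Module ℝ E] [DiffeologicalSpace E]
  [Group H] [DiffeologicalSpace H] {φ : LieChart H E}
  {r : ℕ} {P : MultilinearMap ℝ (fun _ : Fin r => E) ℝ} (hP : φ.IsInvariantPolynomial P)

include hP

namespace LieChart.IsInvariantPolynomial

omit [NormedAddCommGroup V] [NormedSpace ℝ V] [FiniteDimensional ℝ V] in
theorem polyForm_Ad (g : H) (F : V → V → E) :
    polyForm P (fun v w => φ.Ad g (F v w)) = polyForm P F := by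
  funext v
  simp only [polyForm, hP.invariant]

theorem contDiff_apply {f : Fin r → V → E} (hf : ∀ j, Smooth (f j)) :
    ContDiff ℝ ∞ fun x => P fun j => f j x := by
  let e := toEuclidean (E := V)
  have hcoord := (hP.smooth (fun j y => f j (e.symm y)) fun j => hf j _ _ e.symm.contDiff).comp
    e.contDiff
  simpa only [Function.comp_def, ContinuousLinearEquiv.symm_apply_apply] using hcoord

theorem contDiff_polyForm {F : V → V → V → E} (hF : ∀ v w, Smooth fun x => F x v w)
    (v : Fin (2 * r) → V) : ContDiff ℝ ∞ fun x => polyForm P (F x) v :=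
  contDiff_const.mul <|
    ContDiff.sum fun _ _ => contDiff_const.mul (hP.contDiff_apply fun _ => hF _ _)

theorem dSmooth_toLinearMap (ξ : Fin r → E) (j : Fin r) : DSmooth (P.toLinearMap ξ j) := by
  intro n p hp
  refine (hP.smooth (fun i x => Function.update ξ j (p x) i) fun i => ?_).isPlot
  rcases eq_or_ne i j with rfl | hi
  · simpa using hp
  · simpa [hi] using isPlot_const

variable [ConvenientSpace E]

theorem fderiv_apply {f : Fin r → V → E} (hf : ∀ j, Smooth (f j)) (x v : V) :
    fderiv ℝ (fun x => P fun j => f j x) x v =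
      ∑ j, P (Function.update (fun j => f j x) j (dirDeriv (f j) x v)) := by
  have hsplit : ContDiff ℝ ∞ fun z : Fin r → V => P fun j => f j (z j) :=
    hP.contDiff_apply (f := fun j (z : Fin r → V) => f j (z j)) fun j =>
      (hf j).comp (g := fun z : Fin r → V => z j) (by fun_prop)
  rw [fderiv_diag_eq_sum (g := fun z => P fun j => f j (z j))
    (hsplit.differentiable (by simp) _)]
  refine Finset.sum_congr rfl fun j _ => ?_
  have hupdate (y : V) : (P fun i => f i (Function.update (fun _ => x) j y i)) =
      P.toLinearMap (fun i => f i x) j (f j y) := by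
    refine congrArg P (funext fun i => ?_)
    rcases eq_or_ne i j with rfl | hi <;> simp [*]
  simp only [hupdate]
  exact (((hf j).smoothAt x).apply_dirDeriv v (hP.dSmooth_toLinearMap (fun i => f i x) j)).symm

theorem fderiv_polyForm {F : V → V → V → E} (hF : ∀ v w, Smooth fun x => F x v w)
    (v : Fin (2 * r) → V) (x u : V) : fderiv ℝ (fun x => polyForm P (F x) v) x u =
      (1 / 2 : ℝ) ^ r * ∑ τ : Equiv.Perm (Fin (2 * r)), ((Equiv.Perm.sign τ : ℤ) : ℝ) *
        ∑ j₀ : Fin r, P (Function.update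
          (fun j => F x (v (τ (fstSlot j))) (v (τ (sndSlot j)))) j₀
          (dirDeriv (fun y => F y (v (τ (fstSlot j₀))) (v (τ (sndSlot j₀)))) x u)) := by
  have hd (τ : Equiv.Perm (Fin (2 * r))) : DifferentiableAt ℝ
      (fun x => P fun j => F x (v (τ (fstSlot j))) (v (τ (sndSlot j)))) x :=
    (hP.contDiff_apply fun _ => hF _ _).differentiable (by simp) x
  have hsum : HasFDerivAt (fun x => polyForm P (F x) v)
      ((1 / 2 : ℝ) ^ r • ∑ τ : Equiv.Perm (Fin (2 * r)), ((Equiv.Perm.sign τ : ℤ) : ℝ) •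
        fderiv ℝ (fun x => P fun j => F x (v (τ (fstSlot j))) (v (τ (sndSlot j)))) x) x :=
    (HasFDerivAt.fun_sum fun τ _ => (hd τ).hasFDerivAt.const_mul _).const_mul _
  rw [hsum.fderiv]
  simp only [smul_apply, sum_apply, smul_eq_mul, hP.fderiv_apply fun _ => hF _ _]

variable [DiffeologicalGroup H] {m : ℕ} {A : Euc m → Euc m → E} (hA : IsOneForm A)

/-- The Chern–Weil form `P(F,…,F)` of a Lie algebra valued `1`-form, at a point. -/
noncomputable def alternating (x : Euc m) : Euc m [⋀^Fin (2 * r)]→L[ℝ] ℝ :=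
  { ((1 / 2 : ℝ) ^ r • MultilinearMap.alternatization (polyMultilinear P (φ.curvature A x)
      (φ.isLinearMap_curvature_left hA x) (φ.isLinearMap_curvature_right hA x)) :
        Euc m [⋀^Fin (2 * r)]→ₗ[ℝ] ℝ) with
    cont := by
      have hcurv : Smooth fun z : Euc m × Euc m => φ.curvature A x z.1 z.2 :=
        smooth_uncurry (φ.isLinearMap_curvature_right hA x) fun w =>
          smooth_of_isLinearMap (φ.isLinearMap_curvature_left hA x w)
      have hpoly : ContDiff ℝ ∞ fun v : Fin (2 * r) → Euc m => polyForm P (φ.curvature A x) v :=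
        contDiff_const.mul (ContDiff.sum fun τ _ => contDiff_const.mul
          (hP.contDiff_apply fun j => hcurv.comp (g := fun v : Fin (2 * r) → Euc m =>
            (v (τ (fstSlot j)), v (τ (sndSlot j)))) (by fun_prop)))
      exact hpoly.continuous.congr fun v => polyForm_eq_alternatization P _ _ _ v }

theorem alternating_apply (x : Euc m) (v : Fin (2 * r) → Euc m) :
    hP.alternating hA x v = polyForm P (φ.curvature A x) v :=
  (polyForm_eq_alternatization P _ _ _ v).symm

include hA

theorem sum_fderiv_polyForm_eq_zero {x : Euc m} (hx : A x = 0)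
    (v : Fin (2 * r + 1) → Euc m) : ∑ i : Fin (2 * r + 1), (-1 : ℝ) ^ (i : ℕ) *
      fderiv ℝ (fun y => polyForm P (φ.curvature A y) (i.removeNth v)) x (v i) = 0 := by
  simp only [hP.fderiv_polyForm (φ.smooth_curvature hA)]
  exact sum_polyForm_deriv_eq_zero P (F := φ.curvature A x)
    (T := fun u v w => dirDeriv (fun y => φ.curvature A y v w) x u)
    (φ.bianchi_of_eq_zero hA hx) v

end LieChart.IsInvariantPolynomial

end InvariantPolynomials

/-! ### Chern–Weil forms -/

section ChernWeil

open MulOpposite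

section

variable {X : Type*} [DiffeologicalSpace X] {m n : ℕ}

theorem DForm.ext_apply {α β : DForm X n} (h : ∀ m p x v, α.1 m p x v = β.1 m p x v) : α = β :=
  Subtype.ext (funext fun m => funext fun p => funext fun x =>
    ContinuousAlternatingMap.ext fun v => h m p x v)

theorem fderiv_of_eventuallyEq_id {V : Type*} [NormedAddCommGroup V] [NormedSpace ℝ V]
    {ρ : V → V} {x : V} (h : ρ =ᶠ[𝓝 x] id) : fderiv ℝ ρ x = .id ℝ V := by
  rw [h.fderiv_eq, fderiv_id]

theorem DForm.apply_comp_of_eventuallyEq_id (α : DForm X n) (p : Plot X m)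
    {ρ : Euc m → Euc m} (hρ : ContDiff ℝ ∞ ρ) {x : Euc m} (hx : ρ =ᶠ[𝓝 x] id) :
    α.1 m ⟨p.1 ∘ ρ, isPlot_reparam p.2 hρ⟩ x = α.1 m p x := by
  rw [α.2.2 m m p ρ hρ]
  ext v
  simp [fderiv_of_eventuallyEq_id hx, hx.self_of_nhds]

end

variable {X Q H E : Type*} [DiffeologicalSpace X] [DiffeologicalSpace Q]
  [Group H] [DiffeologicalSpace H] [AddCommGroup E] [Module ℝ E] [DiffeologicalSpace E]
  {φ : LieChart H E} {π : Q → X} {m : ℕ}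

theorem LieChart.exists_smooth_logDeriv_eq [ConvenientSpace E] (φ : LieChart H E)
    {ℓ : Euc m → E} (hℓ : IsLinearMap ℝ ℓ) (hℓs : Smooth ℓ) (x : Euc m) :
    ∃ k : Euc m → H, Smooth k ∧ k x = 1 ∧ ∀ v, φ.logDeriv k x v = ℓ v := by
  have hξ : SmoothAt (fun y => ℓ (y - x)) x :=
    (hℓs.comp (g := fun y => y - x) (by fun_prop)).smoothAt x
  have hξx : ℓ (x - x) = 0 := by rw [sub_self, hℓ.map_zero]
  obtain ⟨k, hk, hkξ⟩ := φ.smoothAt_invFun hξ hξx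
  have hkx : k x = 1 :=
    hkξ.self_of_nhds.trans (by simp [hℓ.map_zero, φ.invFun_chart_one])
  refine ⟨k, hk, hkx, fun v => ?_⟩
  have hchart : (fun y => φ.toFun ((k x)⁻¹ * k y)) =ᶠ[𝓝 x]
      fun y => φ.toFun (φ.invFun (φ.toFun 1 + ℓ (y - x))) := by
    filter_upwards [hkξ] with y hy
    rw [hkx, inv_one, one_mul, hy]
  rw [φ.logDeriv_eq_dirDeriv, dirDeriv_congr hchart, φ.dirDeriv_chart_invFun hξ hξx,
    dirDeriv_comp (f := ℓ) (hℓs.smoothAt _) (by fun_prop), dirDeriv_of_isLinearMap hℓ,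
    fderiv_sub_const, fderiv_fun_id]
  rfl

variable [MulAction Hᵐᵒᵖ Q]

namespace Connection

variable (Θ : Connection φ Q)

theorem isOneForm (q : Plot Q m) : IsOneForm (Θ.form m q) :=
  ⟨Θ.linear m q, fun v => smooth_iff_isPlot.2 (Θ.smooth m q v)⟩

theorem eventually_form_comp_eq (q : Plot Q m) {ρ : Euc m → Euc m} (hρ : ContDiff ℝ ∞ ρ)
    {x : Euc m} (hx : ρ =ᶠ[𝓝 x] id) :
    ∀ᶠ y in 𝓝 x, Θ.form m ⟨q.1 ∘ ρ, isPlot_reparam q.2 hρ⟩ y = Θ.form m q y := by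
  filter_upwards [hx.eventually_nhds] with y hy
  funext v
  rw [Θ.pullback m m q ρ hρ, fderiv_of_eventuallyEq_id hy, hy.self_of_nhds]
  rfl

theorem curvature_form_comp [ConvenientSpace E] {k : ℕ} (q : Plot Q m) {f : Euc k → Euc m}
    (hf : ContDiff ℝ ∞ f) (x v w : Euc k) :
    φ.curvature (Θ.form k ⟨q.1 ∘ f, isPlot_reparam q.2 hf⟩) x v w =
      φ.curvature (Θ.form m q) (f x) (fderiv ℝ f x v) (fderiv ℝ f x w) := by
  rw [← φ.curvature_pullback (Θ.isOneForm q) hf]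
  congr 1
  exact funext fun y => funext fun u => Θ.pullback m k q f hf y u

theorem exists_form_eventuallyEq_gauge (hπ : IsPrincipalBundle H π) (q q' : Plot Q m)
    {x : Euc m} (hqq' : ∀ᶠ y in 𝓝 x, π (q.1 y) = π (q'.1 y)) :
    ∃ k : Euc m → H, Smooth k ∧
      Θ.form m q' =ᶠ[𝓝 x] fun y v => φ.Ad (k y)⁻¹ (Θ.form m q y v) + φ.logDeriv k y v := by
  obtain ⟨ρ, hρ, hρx, hπρ⟩ := exists_contDiff_eventuallyEq_id hqq'
  choose k hk using fun y => (hπ.fibre _ _).1 (hπρ y)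
  have hq := isPlot_reparam q.2 hρ
  have hq' := isPlot_reparam q'.2 hρ
  have hact : q'.1 ∘ ρ = fun y => op (k y) • (q.1 ∘ ρ) y := funext hk
  have hkp : IsPlot k := hπ.smooth_div hq (hact ▸ hq')
  refine ⟨k, smooth_iff_isPlot.2 hkp, ?_⟩
  filter_upwards [Θ.eventually_form_comp_eq q hρ hρx, Θ.eventually_form_comp_eq q' hρ hρx]
    with y hy hy'
  have hplot : (⟨q'.1 ∘ ρ, hq'⟩ : Plot Q m) = ⟨fun y => op (k y) • (q.1 ∘ ρ) y, hact ▸ hq'⟩ :=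
    Subtype.ext hact
  funext v
  rw [← hy, ← hy', hplot]
  exact Θ.gauge m ⟨q.1 ∘ ρ, hq⟩ k hkp (hact ▸ hq') y v

theorem exists_curvature_eq_Ad [DiffeologicalGroup H] [ConvenientSpace E]
    (hπ : IsPrincipalBundle H π) (q q' : Plot Q m) {x : Euc m}
    (hqq' : ∀ᶠ y in 𝓝 x, π (q.1 y) = π (q'.1 y)) : ∃ g : H,
      φ.curvature (Θ.form m q') x = fun v w => φ.Ad g (φ.curvature (Θ.form m q) x v w) := by
  obtain ⟨k, hk, hform⟩ := Θ.exists_form_eventuallyEq_gauge hπ q q' hqq'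
  refine ⟨(k x)⁻¹, ?_⟩
  rw [φ.curvature_congr hform]
  funext v w
  exact φ.curvature_gauge (fun v => ((Θ.isOneForm q).smooth v).smoothAt x) (hk.smoothAt x) v w

theorem exists_lift_form_eq_zero [DiffeologicalGroup H] [ConvenientSpace E]
    (hπ : IsPrincipalBundle H π) (p : Plot X m) (x : Euc m) :
    ∃ q : Plot Q m, (∀ᶠ y in 𝓝 x, π (q.1 y) = p.1 y) ∧ Θ.form m q x = 0 := by
  obtain ⟨q, hq, hlift⟩ := hπ.lift p.1 p.2 x
  have hA : IsOneForm (Θ.form m ⟨q, hq⟩) := Θ.isOneForm _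
  have hneg : IsLinearMap ℝ fun v => -Θ.form m ⟨q, hq⟩ x v := (-(hA.linear x).mk' _).isLinear
  obtain ⟨k, hk, hkx, hlogDeriv⟩ :=
    φ.exists_smooth_logDeriv_eq hneg (smooth_of_isLinearMap hneg) x
  have hkp := smooth_iff_isPlot.1 hk
  refine ⟨⟨fun y => op (k y) • q y, hπ.smooth_act hq hkp⟩, ?_, funext fun v => ?_⟩
  · filter_upwards [hlift] with y hy
    rw [← hy]
    exact ((hπ.fibre _ _).2 ⟨k y, rfl⟩).symm
  · rw [Θ.gauge m ⟨q, hq⟩ k hkp, hkx, inv_one, φ.Ad_one, hlogDeriv]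
    exact add_neg_cancel _

end Connection

namespace IsPrincipalBundle

variable (hπ : IsPrincipalBundle H π)

/-- A chosen plot of the total space that lifts the plot `p` of the base near `x`. -/
noncomputable def localLift (p : Plot X m) (x : Euc m) : Plot Q m :=
  ⟨(hπ.lift p.1 p.2 x).choose, (hπ.lift p.1 p.2 x).choose_spec.1⟩

theorem eventually_proj_localLift (p : Plot X m) (x : Euc m) :
    ∀ᶠ y in 𝓝 x, π ((hπ.localLift p x).1 y) = p.1 y :=
  (hπ.lift p.1 p.2 x).choose_spec.2

end IsPrincipalBundle

namespace Connection

variable [DiffeologicalGroup H] [ConvenientSpace E] (Θ : Connection φ Q)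
  {r : ℕ} {P : MultilinearMap ℝ (fun _ : Fin r => E) ℝ}
  (hπ : IsPrincipalBundle H π) (hP : φ.IsInvariantPolynomial P)

include hπ hP in
theorem polyForm_curvature_eq (q q' : Plot Q m) {x : Euc m}
    (hqq' : ∀ᶠ y in 𝓝 x, π (q.1 y) = π (q'.1 y)) :
    polyForm P (φ.curvature (Θ.form m q') x) = polyForm P (φ.curvature (Θ.form m q) x) := by
  obtain ⟨g, hg⟩ := Θ.exists_curvature_eq_Ad hπ q q' hqq'
  rw [hg, hP.polyForm_Ad]

/-- The Chern–Weil form `P(F,…,F)` of a connection in a plot of the base, computed at each point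
`x` from the curvature `F` along the chosen local lift at `x`. -/
noncomputable def chernWeilPlot (m : ℕ) (p : Plot X m) (x : Euc m) :
    Euc m [⋀^Fin (2 * r)]→L[ℝ] ℝ :=
  hP.alternating (Θ.isOneForm (hπ.localLift p x)) x

theorem chernWeilPlot_apply (p : Plot X m) {x : Euc m} (q : Plot Q m)
    (hq : ∀ᶠ y in 𝓝 x, π (q.1 y) = p.1 y) (v : Fin (2 * r) → Euc m) :
    Θ.chernWeilPlot hπ hP m p x v = polyForm P (φ.curvature (Θ.form m q) x) v := by
  rw [chernWeilPlot, hP.alternating_apply, Θ.polyForm_curvature_eq hπ hP q]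
  filter_upwards [hq, hπ.eventually_proj_localLift p x] with y hy hy'
  rw [hy, hy']

theorem contDiff_chernWeilPlot (p : Plot X m) : ContDiff ℝ ∞ (Θ.chernWeilPlot hπ hP m p) := by
  refine contDiff_continuousAlternatingMap_of_apply fun v => contDiff_iff_contDiffAt.2 fun x => ?_
  have hcurv := φ.smooth_curvature (Θ.isOneForm (hπ.localLift p x))
  refine (hP.contDiff_polyForm hcurv v).contDiffAt.congr_of_eventuallyEq ?_
  filter_upwards [(hπ.eventually_proj_localLift p x).eventually_nhds] with y hy
  exact Θ.chernWeilPlot_apply hπ hP p _ hy v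

theorem chernWeilPlot_comp {k : ℕ} (p : Plot X m) {f : Euc k → Euc m} (hf : ContDiff ℝ ∞ f)
    (x : Euc k) : Θ.chernWeilPlot hπ hP k ⟨p.1 ∘ f, isPlot_reparam p.2 hf⟩ x =
      (Θ.chernWeilPlot hπ hP m p (f x)).compContinuousLinearMap (fderiv ℝ f x) := by
  let q := hπ.localLift p (f x)
  have hq : ∀ᶠ y in 𝓝 (f x), π (q.1 y) = p.1 y := hπ.eventually_proj_localLift p (f x)
  ext v
  rw [ContinuousAlternatingMap.compContinuousLinearMap_apply, Θ.chernWeilPlot_apply hπ hP p q hq,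
    Θ.chernWeilPlot_apply hπ hP ⟨p.1 ∘ f, _⟩ ⟨q.1 ∘ f, isPlot_reparam q.2 hf⟩
      (hf.continuous.continuousAt.eventually hq)]
  simp only [polyForm, Θ.curvature_form_comp q hf, Function.comp_apply]

/-- The Chern–Weil form `P(F,…,F)` of a connection, as a differential form on the base. -/
noncomputable def chernWeil : DForm X (2 * r) :=
  ⟨Θ.chernWeilPlot hπ hP, fun _ => Θ.contDiff_chernWeilPlot hπ hP,
    fun _ _ p _ hf => funext (Θ.chernWeilPlot_comp hπ hP p hf)⟩

theorem chernWeil_apply (p : Plot X m) {x : Euc m} (q : Plot Q m)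
    (hq : ∀ᶠ y in 𝓝 x, π (q.1 y) = p.1 y) (v : Fin (2 * r) → Euc m) :
    (Θ.chernWeil hπ hP).1 m p x v = polyForm P (φ.curvature (Θ.form m q) x) v :=
  Θ.chernWeilPlot_apply hπ hP p q hq v

theorem extD_chernWeil : extD X (2 * r) (Θ.chernWeil hπ hP) = 0 := by
  refine DForm.ext_apply fun m p x v => ?_
  change extDeriv ((Θ.chernWeil hπ hP).1 m p) x v = 0
  rw [extDeriv_apply (DForm.differentiable _ m p x)]
  obtain ⟨q, hq, hqx⟩ := Θ.exists_lift_form_eq_zero hπ p x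
  rw [← hP.sum_fderiv_polyForm_eq_zero (Θ.isOneForm q) hqx v]
  refine Finset.sum_congr rfl fun i _ => ?_
  have heq : (fun y => (Θ.chernWeil hπ hP).1 m p y (i.removeNth v)) =ᶠ[𝓝 x]
      fun y => polyForm P (φ.curvature (Θ.form m q) y) (i.removeNth v) := by
    filter_upwards [hq.eventually_nhds] with y hy
    exact Θ.chernWeil_apply hπ hP p q hy _
  rw [heq.fderiv_eq]
  simp [zsmul_eq_mul]

variable {ι : Type*} (S : LocalSections π ι)

theorem gluesConnection_chernWeil : GluesConnection φ P S Θ (Θ.chernWeil hπ hP) :=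
  fun k m p hp hU _ v =>
    Θ.chernWeil_apply hπ hP ⟨p, hp⟩ ⟨S.sec k ∘ p, S.smooth_sec k m p hp hU⟩
      (.of_forall fun y => S.proj_sec k _ (hU y)) v

end Connection

theorem GluesConnection.unique {r : ℕ} {P : MultilinearMap ℝ (fun _ : Fin r => E) ℝ}
    {ι : Type*} {S : LocalSections π ι} {Θ : Connection φ Q} {η η' : DForm X (2 * r)}
    (hη : GluesConnection φ P S Θ η) (hη' : GluesConnection φ P S Θ η') : η = η' := by
  refine DForm.ext_apply fun m p x v => ?_
  obtain ⟨k, hk⟩ := S.cover (p.1 x)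
  have hU : p.1 ⁻¹' S.U k ∈ 𝓝 x :=
    (isOpen_iff_preimages_plots.1 (S.isOpen_U k) m p.1 p.2).mem_nhds hk
  obtain ⟨ρ, hρ, hρx, hρU⟩ := exists_contDiff_eventuallyEq_id hU
  rw [← η.apply_comp_of_eventuallyEq_id p hρ hρx, ← η'.apply_comp_of_eventuallyEq_id p hρ hρx]
  exact (hη k m _ _ hρU x v).trans (hη' k m _ _ hρU x v).symm

end ChernWeil

/-! ### Homotopy invariance -/

section FibreIntegral

variable {V : Type*} [NormedAddCommGroup V] [NormedSpace ℝ V] {n : ℕ}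

theorem contDiff_alternating_apply {W : Type*} [NormedAddCommGroup W] [NormedSpace ℝ W]
    {α : W → V [⋀^Fin n]→L[ℝ] ℝ} {k : WithTop ℕ∞} (hα : ContDiff ℝ k α) (v : Fin n → V) :
    ContDiff ℝ k fun x => α x v :=
  (ContinuousAlternatingMap.apply ℝ V ℝ v).contDiff.comp hα

theorem contDiff_extDeriv {α : V → V [⋀^Fin n]→L[ℝ] ℝ} (hα : ContDiff ℝ ∞ α) :
    ContDiff ℝ ∞ (extDeriv α) :=
  (ContinuousAlternatingMap.alternatizeUncurryFinCLM ℝ V ℝ).contDiff.comp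
    (hα.fderiv_right (by simp))

/-- The tuple `(∂ₜ, v₁, …, vₙ)` of vectors in `ℝ × V`. -/
def timeCons (v : Fin n → V) : Fin (n + 1) → ℝ × V := Fin.cons (1, 0) fun i => (0, v i)

omit [NormedSpace ℝ V] in
theorem removeNth_zero_timeCons (v : Fin n → V) :
    (0 : Fin (n + 1)).removeNth (timeCons v) = fun i => (0, v i) := by
  funext j
  simp [timeCons, Fin.removeNth]

omit [NormedSpace ℝ V] in
theorem removeNth_succ_timeCons (v : Fin (n + 1) → V) (i : Fin (n + 1)) :
    i.succ.removeNth (timeCons v) = timeCons (i.removeNth v) := by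
  funext j
  refine Fin.cases ?_ (fun j => ?_) j <;> simp [timeCons, Fin.removeNth]

/-- The fibre integral over `[0, 1]` of a form on `ℝ × V`: contraction with `∂ₜ`, restriction to
the slices, integration in `t`. -/
noncomputable def fibreIntegral (α : ℝ × V → (ℝ × V) [⋀^Fin (n + 1)]→L[ℝ] ℝ) (x : V) :
    V [⋀^Fin n]→L[ℝ] ℝ :=
  ∫ t in (0 : ℝ)..1, ((α (t, x)).curryLeft (1, 0)).compContinuousLinearMap
    (ContinuousLinearMap.inr ℝ ℝ V)

theorem extDeriv_timeCons {α : ℝ × V → (ℝ × V) [⋀^Fin (n + 1)]→L[ℝ] ℝ} {z : ℝ × V}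
    (hα : DifferentiableAt ℝ α z) (v : Fin (n + 1) → V) :
    extDeriv α z (timeCons v) = fderiv ℝ (fun y => α y fun i => (0, v i)) z (1, 0) -
      ∑ i : Fin (n + 1), (-1) ^ (i : ℕ) *
        fderiv ℝ (fun y => α y (timeCons (i.removeNth v))) z (0, v i) := by
  rw [extDeriv_apply hα, Fin.sum_univ_succ, removeNth_zero_timeCons, sub_eq_add_neg,
    ← Finset.sum_neg_distrib]
  simp only [removeNth_succ_timeCons]
  simp [timeCons, pow_succ]

variable {α : ℝ × V → (ℝ × V) [⋀^Fin (n + 1)]→L[ℝ] ℝ} (hα : ContDiff ℝ ∞ α)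

include hα

theorem continuous_fderiv_alternating_apply (x : V) (u : Fin (n + 1) → ℝ × V) (w : ℝ × V) :
    Continuous fun t : ℝ => fderiv ℝ (fun z => α z u) (t, x) w :=
  (((contDiff_alternating_apply hα u).continuous_fderiv (by simp)).comp (by fun_prop)).clm_apply
    continuous_const

theorem integral_fderiv_time (x : V) (u : Fin (n + 1) → ℝ × V) :
    ∫ t in (0 : ℝ)..1, fderiv ℝ (fun z => α z u) (t, x) (1, 0) = α (1, x) u - α (0, x) u := by
  have hf := contDiff_alternating_apply hα u
  exact intervalIntegral.integral_eq_sub_of_hasDerivAt (f := fun t => α (t, x) u)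
    (fun t _ => HasFDerivAt.comp_hasDerivAt t (l := fun z => α z u)
      (hf.differentiable (by simp) _).hasFDerivAt
      ((hasDerivAt_id t).prodMk (hasDerivAt_const t x)))
    ((continuous_fderiv_alternating_apply hα x u (1, 0)).intervalIntegrable _ _)

variable [FiniteDimensional ℝ V]

theorem contDiff_curryLeft_comp_inr : ContDiff ℝ ∞ fun z : V × ℝ =>
    ((α (z.2, z.1)).curryLeft (1, 0)).compContinuousLinearMap (ContinuousLinearMap.inr ℝ ℝ V) :=
  contDiff_continuousAlternatingMap_of_apply fun v =>
    (contDiff_alternating_apply hα (timeCons v)).comp (contDiff_snd.prodMk contDiff_fst)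

theorem contDiff_fibreIntegral : ContDiff ℝ ∞ (fibreIntegral α) :=
  contDiff_intervalIntegral (contDiff_curryLeft_comp_inr hα) 0 1

theorem fibreIntegral_apply (x : V) (v : Fin n → V) :
    fibreIntegral α x v = ∫ t in (0 : ℝ)..1, α (t, x) (timeCons v) :=
  (ContinuousLinearMap.intervalIntegral_comp_comm (ContinuousAlternatingMap.apply ℝ V ℝ v)
    (((contDiff_curryLeft_comp_inr hα).continuous.comp
      (by fun_prop : Continuous fun t : ℝ => (x, t))).intervalIntegrable _ _)).symm

theorem fderiv_fibreIntegral_apply (x w : V) (v : Fin n → V) :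
    fderiv ℝ (fun y => fibreIntegral α y v) x w =
      ∫ t in (0 : ℝ)..1, fderiv ℝ (fun z => α z (timeCons v)) (t, x) (0, w) := by
  have hf := contDiff_alternating_apply hα (timeCons v)
  have hswap : ContDiff ℝ ∞ fun z : V × ℝ => α (z.2, z.1) (timeCons v) :=
    hf.comp (contDiff_snd.prodMk contDiff_fst)
  simp only [fibreIntegral_apply hα]
  rw [fderiv_intervalIntegral_apply (hswap.of_le (by simp))]
  refine intervalIntegral.integral_congr fun t _ => ?_
  have hderiv : HasFDerivAt (fun z : V × ℝ => α (z.2, z.1) (timeCons v))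
      ((fderiv ℝ (fun z => α z (timeCons v)) (t, x)).comp
        ((ContinuousLinearMap.snd ℝ V ℝ).prod (ContinuousLinearMap.fst ℝ V ℝ))) (x, t) :=
    HasFDerivAt.comp (x, t) (g := fun z => α z (timeCons v)) (f := fun z : V × ℝ => (z.2, z.1))
      (hf.differentiable (by simp) _).hasFDerivAt (hasFDerivAt_snd.prodMk hasFDerivAt_fst)
  simp [hderiv.fderiv]

theorem extDeriv_fibreIntegral_apply (x : V) (v : Fin (n + 1) → V) :
    extDeriv (fibreIntegral α) x v = ∫ t in (0 : ℝ)..1, ∑ i : Fin (n + 1), (-1) ^ (i : ℕ) *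
      fderiv ℝ (fun z => α z (timeCons (i.removeNth v))) (t, x) (0, v i) := by
  rw [extDeriv_apply ((contDiff_fibreIntegral hα).differentiable (by simp) x),
    intervalIntegral.integral_finsetSum fun i _ => ((continuous_fderiv_alternating_apply hα x
      (timeCons (i.removeNth v)) (0, v i)).const_mul ((-1) ^ (i : ℕ))).intervalIntegrable _ _]
  refine Finset.sum_congr rfl fun i _ => ?_
  rw [fderiv_fibreIntegral_apply hα, intervalIntegral.integral_const_mul]
  simp [zsmul_eq_mul]

theorem fibreIntegral_homotopy_formula (x : V) (v : Fin (n + 1) → V) :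
    extDeriv (fibreIntegral α) x v + fibreIntegral (extDeriv α) x v =
      α (1, x) (fun i => (0, v i)) - α (0, x) fun i => (0, v i) := by
  rw [fibreIntegral_apply (contDiff_extDeriv hα), extDeriv_fibreIntegral_apply hα,
    ← integral_fderiv_time hα]
  simp only [extDeriv_timeCons (hα.differentiable (by simp) _)]
  rw [intervalIntegral.integral_sub, add_sub_cancel]
  · exact (continuous_fderiv_alternating_apply hα x _ _).intervalIntegrable _ _
  · exact (continuous_finsetSum _ fun i _ => continuous_const.mul
      (continuous_fderiv_alternating_apply hα x _ _)).intervalIntegrable _ _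

end FibreIntegral

section Cylinder

/-- The cylinder `X × ℝ`, with the product diffeology. -/
@[ext]
structure Cylinder (X : Type*) where
  pt : X
  time : ℝ

variable {X : Type*} [DiffeologicalSpace X]

instance : DiffeologicalSpace (Cylinder X) where
  plots m := {p | IsPlot (fun x : Euc m => (p x).pt) ∧ IsPlot fun x : Euc m => (p x).time}
  constant_plots _ := ⟨isPlot_const, isPlot_const⟩
  plot_reparam {n m p f} hp hf :=
    ⟨isPlot_reparam (p := fun x => (p x).pt) hp.1 hf,
      isPlot_reparam (p := fun x => (p x).time) hp.2 hf⟩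
  locality {n p} hp := by
    refine ⟨DiffeologicalSpace.locality fun x => ?_, DiffeologicalSpace.locality fun x => ?_⟩
    · obtain ⟨u, hu, hxu, h⟩ := hp x
      exact ⟨u, hu, hxu, fun hf hf' => (h hf hf').1⟩
    · obtain ⟨u, hu, hxu, h⟩ := hp x
      exact ⟨u, hu, hxu, fun hf hf' => (h hf hf').2⟩

variable {m k n : ℕ}

/-- The plot of the cylinder `X × ℝ` obtained by composing `g` with `p × ℝ`. -/
def Plot.cylinder (p : Plot X m) {g : Euc k → ℝ × Euc m} (hg : ContDiff ℝ ∞ g) :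
    Plot (Cylinder X) k :=
  ⟨fun y => ⟨p.1 (g y).2, (g y).1⟩, isPlot_reparam p.2 hg.snd, hg.fst.isPlot⟩

/-- The plot `p` of `X`, placed in the slice of the cylinder at time `s`. -/
def Plot.slice (p : Plot X m) (s : ℝ) : Plot (Cylinder X) m :=
  ⟨fun y => ⟨p.1 y, s⟩, p.2, isPlot_const⟩

/-- A linear identification of `ℝ^(m+1)` with `ℝ × ℝ^m`, needed because plots are indexed by the
spaces `Euc m` only. -/
noncomputable def eucSuccEquiv (m : ℕ) : Euc (m + 1) ≃L[ℝ] ℝ × Euc m :=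
  ContinuousLinearEquiv.ofFinrankEq (by simp [add_comm])

/-- The pull-back of a form on the cylinder `X × ℝ` along `p × ℝ`, for a plot `p` of `X`. -/
noncomputable def cylinderForm (α : DForm (Cylinder X) n) (p : Plot X m) (z : ℝ × Euc m) :
    (ℝ × Euc m) [⋀^Fin n]→L[ℝ] ℝ :=
  (α.1 (m + 1) (p.cylinder (eucSuccEquiv m).contDiff)
    ((eucSuccEquiv m).symm z)).compContinuousLinearMap (eucSuccEquiv m).symm

section

variable (α : DForm (Cylinder X) n)

theorem contDiff_cylinderForm (p : Plot X m) : ContDiff ℝ ∞ (cylinderForm α p) :=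
  contDiff_continuousAlternatingMap_of_apply fun v => contDiff_alternating_apply
    ((α.2.1 _ _).comp (eucSuccEquiv m).symm.contDiff) fun i => (eucSuccEquiv m).symm (v i)

theorem apply_cylinder (p : Plot X m) {g : Euc k → ℝ × Euc m} (hg : ContDiff ℝ ∞ g)
    (y : Euc k) (v : Fin n → Euc k) :
    α.1 k (p.cylinder hg) y v = cylinderForm α p (g y) fun i => fderiv ℝ g y (v i) := by
  let e := eucSuccEquiv m
  have hplot : (⟨(p.cylinder e.contDiff).1 ∘ fun y => e.symm (g y),
      isPlot_reparam (p.cylinder e.contDiff).2 (e.symm.contDiff.comp hg)⟩ : Plot (Cylinder X) k) =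
      p.cylinder hg := Subtype.ext (funext fun y => by simp [Plot.cylinder])
  have hfderiv : fderiv ℝ (fun y => e.symm (g y)) y =
      (e.symm : _ →L[ℝ] _).comp (fderiv ℝ g y) :=
    (e.symm.toContinuousLinearMap.hasFDerivAt.comp y
      (hg.differentiable (by simp) y).hasFDerivAt).fderiv
  rw [← hplot]
  refine (congrArg (fun β => β y v) (α.2.2 (m + 1) k (p.cylinder e.contDiff)
    (fun y => e.symm (g y)) (e.symm.contDiff.comp hg))).trans ?_
  beta_reduce
  rw [hfderiv]
  rfl

theorem apply_slice (p : Plot X m) (s : ℝ) (x : Euc m) (v : Fin n → Euc m) :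
    α.1 m (p.slice s) x v = cylinderForm α p (s, x) fun i => (0, v i) := by
  have hg : ContDiff ℝ ∞ fun y : Euc m => (s, y) := by fun_prop
  refine (apply_cylinder α p hg x v).trans ?_
  rw [(hasFDerivAt_prodMk_right s x).fderiv]
  rfl

theorem cylinderForm_comp (p : Plot X m) {f : Euc k → Euc m} (hf : ContDiff ℝ ∞ f)
    (t : ℝ) (x : Euc k) (v : Fin n → ℝ × Euc k) :
    cylinderForm α ⟨p.1 ∘ f, isPlot_reparam p.2 hf⟩ (t, x) v =
      cylinderForm α p (t, f x) fun i => ((v i).1, fderiv ℝ f x (v i).2) := by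
  let e := eucSuccEquiv k
  have hprod : HasFDerivAt (fun z : ℝ × Euc k => (z.1, f z.2))
      ((ContinuousLinearMap.fst ℝ ℝ (Euc k)).prod
        ((fderiv ℝ f x).comp (ContinuousLinearMap.snd ℝ ℝ (Euc k)))) (t, x) :=
    hasFDerivAt_fst.prodMk (HasFDerivAt.comp (t, x) (g := f)
      (hf.differentiable (by simp) x).hasFDerivAt hasFDerivAt_snd)
  have hfderiv : HasFDerivAt (fun y => ((e y).1, f (e y).2)) _ (e.symm (t, x)) :=
    HasFDerivAt.comp (e.symm (t, x)) (g := fun z : ℝ × Euc k => (z.1, f z.2)) (f := e)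
      (by rw [e.apply_symm_apply]; exact hprod) e.toContinuousLinearMap.hasFDerivAt
  have hsmooth : ContDiff ℝ ∞ fun y => ((e y).1, f (e y).2) :=
    e.contDiff.fst.prodMk (hf.comp e.contDiff.snd)
  refine (apply_cylinder α p hsmooth (e.symm (t, x)) fun i => e.symm (v i)).trans ?_
  rw [hfderiv.fderiv]
  simp

theorem extDeriv_cylinderForm (p : Plot X m) :
    extDeriv (cylinderForm α p) = cylinderForm (extD (Cylinder X) n α) p := by
  let e := eucSuccEquiv m
  let c := p.cylinder e.contDiff
  have hpullback : cylinderForm α p = fun z =>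
      (α.1 (m + 1) c (e.symm z)).compContinuousLinearMap (fderiv ℝ e.symm z) := by
    funext z
    rw [e.symm.fderiv]
    rfl
  funext z
  rw [hpullback, extDeriv_pullback (r := ∞) (DForm.differentiable α _ c _)
    e.symm.contDiff.contDiffAt (by
      rw [minSmoothness_of_isRCLikeNormedField]
      exact WithTop.coe_le_coe.2 (le_top (a := (2 : ℕ∞)))), e.symm.fderiv]
  rfl

end

theorem fibreIntegral_cylinderForm_comp (α : DForm (Cylinder X) (n + 1)) (p : Plot X m)
    {f : Euc k → Euc m} (hf : ContDiff ℝ ∞ f) (x : Euc k) :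
    fibreIntegral (cylinderForm α ⟨p.1 ∘ f, isPlot_reparam p.2 hf⟩) x =
      (fibreIntegral (cylinderForm α p) (f x)).compContinuousLinearMap (fderiv ℝ f x) := by
  ext v
  rw [fibreIntegral_apply (contDiff_cylinderForm α _),
    ContinuousAlternatingMap.compContinuousLinearMap_apply,
    fibreIntegral_apply (contDiff_cylinderForm α _)]
  refine intervalIntegral.integral_congr fun t _ => ?_
  refine (cylinderForm_comp α p hf t x _).trans (congrArg _ (funext fun i => ?_))
  refine Fin.cases ?_ (fun i => ?_) i <;> simp [timeCons]

/-- The homotopy operator: integration of a form on `X × ℝ` over the fibres `[0, 1]`. -/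
noncomputable def homotopyOperator (α : DForm (Cylinder X) (n + 1)) : DForm X n :=
  ⟨fun _ p => fibreIntegral (cylinderForm α p),
    fun _ p => contDiff_fibreIntegral (contDiff_cylinderForm α p),
    fun _ _ p _ hf => funext (fibreIntegral_cylinderForm_comp α p hf)⟩

theorem homotopyOperator_homotopy_formula (α : DForm (Cylinder X) (n + 1)) (p : Plot X m)
    (x : Euc m) (v : Fin (n + 1) → Euc m) :
    (extD X n (homotopyOperator α) + homotopyOperator (extD (Cylinder X) (n + 1) α)).1 m p x v =
      α.1 m (p.slice 1) x v - α.1 m (p.slice 0) x v := by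
  rw [apply_slice, apply_slice, ← fibreIntegral_homotopy_formula (contDiff_cylinderForm α p),
    extDeriv_cylinderForm]
  rfl

theorem homotopyOperator_zero : homotopyOperator (0 : DForm (Cylinder X) (n + 1)) = 0 :=
  DForm.ext_apply fun m p x v => by
    refine (fibreIntegral_apply (contDiff_cylinderForm _ _) x v).trans ?_
    exact intervalIntegral.integral_zero

theorem sub_mem_exactForms_of_slice {α : DForm (Cylinder X) (n + 1)}
    (hα : extD (Cylinder X) (n + 1) α = 0) {η₀ η₁ : DForm X (n + 1)}
    (hη₀ : ∀ m p x v, η₀.1 m p x v = α.1 m (Plot.slice p 0) x v)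
    (hη₁ : ∀ m p x v, η₁.1 m p x v = α.1 m (Plot.slice p 1) x v) :
    η₁ - η₀ ∈ exactForms X (n + 1) := by
  refine ⟨homotopyOperator α, DForm.ext_apply fun m p x v => ?_⟩
  have hformula := homotopyOperator_homotopy_formula α p x v
  rw [hα, homotopyOperator_zero, add_zero, ← hη₀, ← hη₁] at hformula
  exact hformula

end Cylinder

section CylinderBundle

open MulOpposite

variable {X Q H E : Type*} [DiffeologicalSpace X] [DiffeologicalSpace Q]
  [Group H] [DiffeologicalSpace H] [MulAction Hᵐᵒᵖ Q]
  [AddCommGroup E] [Module ℝ E] [DiffeologicalSpace E]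
  {φ : LieChart H E} {π : Q → X} {m : ℕ}

instance : MulAction Hᵐᵒᵖ (Cylinder Q) where
  smul h q := ⟨h • q.pt, q.time⟩
  one_smul q := Cylinder.ext (one_smul _ q.pt) rfl
  mul_smul g h q := Cylinder.ext (mul_smul g h q.pt) rfl

/-- The projection `π × ℝ` of the cylinder over a bundle. -/
def cylinderProj (π : Q → X) (q : Cylinder Q) : Cylinder X := ⟨π q.pt, q.time⟩

theorem IsPrincipalBundle.cylinder (hπ : IsPrincipalBundle H π) :
    IsPrincipalBundle H (cylinderProj π) where
  smooth_proj n p hp := ⟨hπ.smooth_proj n _ hp.1, hp.2⟩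
  smooth_act hq hh := ⟨hπ.smooth_act hq.1 hh, hq.2⟩
  fibre q q' := by
    constructor
    · intro h
      obtain ⟨g, hg⟩ := (hπ.fibre q.pt q'.pt).1 (congrArg Cylinder.pt h)
      exact ⟨g, Cylinder.ext hg (congrArg Cylinder.time h).symm⟩
    · rintro ⟨g, rfl⟩
      exact Cylinder.ext ((hπ.fibre q.pt _).2 ⟨g, rfl⟩) rfl
  free q h hh := hπ.free q.pt h (congrArg Cylinder.pt hh)
  smooth_div hq hqh := hπ.smooth_div hq.1 hqh.1
  lift p hp x := by
    obtain ⟨q, hq, hqx⟩ := hπ.lift _ hp.1 x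
    exact ⟨fun y => ⟨q y, (p y).time⟩, ⟨hq, hp.2⟩, hqx.mono fun y hy => Cylinder.ext hy rfl⟩

/-- The `Q`-component of a plot of the cylinder `Q × ℝ`. -/
def Plot.pt (q : Plot (Cylinder Q) m) : Plot Q m := ⟨fun y => (q.1 y).pt, q.2.1⟩

namespace Connection

variable [DiffeologicalGroup H] [ConvenientSpace E] (Θ₀ Θ₁ : Connection φ Q)

/-- The affine homotopy `(1 - t) Θ₀ + t Θ₁` between two connections, as a connection on the
cylinder `Q × ℝ`. -/
def homotopy : Connection φ (Cylinder Q) where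
  form m q x v := (1 - (q.1 x).time) • Θ₀.form m q.pt x v + (q.1 x).time • Θ₁.form m q.pt x v
  linear m q x :=
    ((1 - (q.1 x).time) • (Θ₀.linear m q.pt x).mk' _ +
      (q.1 x).time • (Θ₁.linear m q.pt x).mk' _).isLinear
  smooth m q v := by
    have htime : Smooth fun x => (q.1 x).time := smooth_iff_isPlot.2 q.2.2
    have htime' : Smooth fun x => 1 - (q.1 x).time :=
      smooth_iff_contDiff.2 (contDiff_const.sub (smooth_iff_contDiff.1 htime))
    exact smooth_iff_isPlot.1 (smooth_of_forall_smoothAt fun x => SmoothAt.add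
      (SmoothAt.smul (htime'.smoothAt x) (((Θ₀.isOneForm q.pt).smooth v).smoothAt x))
      (SmoothAt.smul (htime.smoothAt x) (((Θ₁.isOneForm q.pt).smooth v).smoothAt x)))
  pullback m k q f hf x v :=
    congrArg₂ (fun ξ η => (1 - (q.1 (f x)).time) • ξ + (q.1 (f x)).time • η)
      (Θ₀.pullback m k q.pt f hf x v) (Θ₁.pullback m k q.pt f hf x v)
  gauge m q h hh hq x v := by
    refine (congrArg₂ (fun ξ η => (1 - (q.1 x).time) • ξ + (q.1 x).time • η)
      (Θ₀.gauge m q.pt h hh hq.1 x v) (Θ₁.gauge m q.pt h hh hq.1 x v)).trans ?_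
    rw [φ.Ad_add, φ.Ad_smul, φ.Ad_smul]
    module

theorem homotopy_form_slice (q : Plot Q m) (s : ℝ) :
    (Θ₀.homotopy Θ₁).form m (q.slice s) =
      fun x v => (1 - s) • Θ₀.form m q x v + s • Θ₁.form m q x v :=
  rfl

variable {r : ℕ} {P : MultilinearMap ℝ (fun _ : Fin r => E) ℝ}
  (hπ : IsPrincipalBundle H π) (hP : φ.IsInvariantPolynomial P)

theorem chernWeil_slice {Θ : Connection φ (Cylinder Q)} {Θₛ : Connection φ Q} {s : ℝ}
    (hs : ∀ m (q : Plot Q m), Θ.form m (q.slice s) = Θₛ.form m q)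
    (p : Plot X m) (x : Euc m) (v : Fin (2 * r) → Euc m) :
    (Θₛ.chernWeil hπ hP).1 m p x v =
      (Θ.chernWeil hπ.cylinder hP).1 m (p.slice s) x v := by
  have hlift := hπ.eventually_proj_localLift p x
  rw [Θₛ.chernWeil_apply hπ hP p _ hlift, Θ.chernWeil_apply hπ.cylinder hP (p.slice s)
    ((hπ.localLift p x).slice s) (hlift.mono fun y hy => Cylinder.ext hy rfl), hs]

include hπ in
theorem chernWeil_eq_of_degree_zero {P : MultilinearMap ℝ (fun _ : Fin 0 => E) ℝ}
    (hP : φ.IsInvariantPolynomial P) : Θ₁.chernWeil hπ hP = Θ₀.chernWeil hπ hP :=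
  DForm.ext_apply fun m p x v => by
    have hlift := hπ.eventually_proj_localLift p x
    rw [Θ₁.chernWeil_apply hπ hP p _ hlift, Θ₀.chernWeil_apply hπ hP p _ hlift]
    simp only [polyForm]
    congr! 3
    exact congrArg P (Subsingleton.elim _ _)

theorem chernWeil_sub_mem_exactForms :
    Θ₁.chernWeil hπ hP - Θ₀.chernWeil hπ hP ∈ exactForms X (2 * r) := by
  cases r with
  | zero =>
    rw [Θ₀.chernWeil_eq_of_degree_zero Θ₁ hπ hP, sub_self]
    exact Submodule.zero_mem _
  | succ r =>
    exact sub_mem_exactForms_of_slice ((Θ₀.homotopy Θ₁).extD_chernWeil hπ.cylinder hP)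
      (fun _ => chernWeil_slice hπ hP fun m q => by simp [homotopy_form_slice])
      (fun _ => chernWeil_slice hπ hP fun m q => by simp [homotopy_form_slice])

end Connection

end CylinderBundle

/-! ### The barycentric connection -/

section Barycentric

open MulOpposite

variable {X Q H : Type*} [DiffeologicalSpace X] [DiffeologicalSpace Q]
  [Group H] [DiffeologicalSpace H] [MulAction Hᵐᵒᵖ Q]
  {π : Q → X} (hπ : IsPrincipalBundle H π) {m : ℕ}

namespace IsPrincipalBundle

include hπ

theorem proj_smul (h : H) (q : Q) : π (op h • q) = π q := ((hπ.fibre _ _).2 ⟨h, rfl⟩).symm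

theorem transition_spec {q q' : Q} (h : π q = π q') : q' = op (transition H q q') • q :=
  Classical.epsilon_spec ((hπ.fibre q q').1 h)

theorem smul_left_injective (q : Q) : Function.Injective fun h : H => op h • q := by
  intro g h heq
  have hstab : op (g * h⁻¹) • q = q := by
    rw [op_mul, mul_smul]
    exact (congrArg (op h⁻¹ • ·) heq).trans (by simp [← mul_smul])
  exact mul_inv_eq_one.1 (hπ.free q _ hstab)

theorem transition_smul {q q' : Q} (h : π q = π q') (g : H) :
    transition H q (op g • q') = transition H q q' * g := by
  refine hπ.smul_left_injective q ?_
  have hg : π q = π (op g • q') := h.trans (hπ.proj_smul g q').symm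
  simp only [op_mul, mul_smul]
  rw [← hπ.transition_spec hg, ← hπ.transition_spec h]

theorem smooth_proj_comp (q : Plot Q m) : Smooth fun y => π (q.1 y) :=
  smooth_iff_isPlot.2 (hπ.smooth_proj m q.1 q.2)

end IsPrincipalBundle

namespace NumerableSections

variable {E ι : Type*} [AddCommGroup E] [Module ℝ E] [DiffeologicalSpace E]
  (φ : LieChart H E) (T : NumerableSections π ι) (q : Plot Q m) (x v : Euc m) (i : ι)

theorem mem_of_lam_ne_zero {i : ι} {a : X} (h : T.lam i a ≠ 0) : a ∈ T.U i :=
  T.lam_supp i (@subset_closure X dTopology _ a h)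

theorem sum_lam_eq_one {a : X} {s : Finset ι} (hs : ∀ i, T.lam i a ≠ 0 → i ∈ s) :
    ∑ i ∈ s, T.lam i a = 1 :=
  (finsum_eq_sum_of_support_subset _ hs).symm.trans (T.lam_sum a)

include hπ in
theorem exists_finset_eventually_lam_ne_zero :
    ∃ s : Finset ι, ∀ᶠ y in 𝓝 x, ∀ i, T.lam i (π (q.1 y)) ≠ 0 → i ∈ s := by
  obtain ⟨t, ht, hfin⟩ := T.locallyFinite (π (q.1 x))
  obtain ⟨u, hut, hu, hxu⟩ := (@mem_nhds_iff X dTopology (π (q.1 x)) t).1 ht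
  refine ⟨hfin.toFinset, ?_⟩
  filter_upwards [((hπ.smooth_proj_comp q).smoothAt x).eventually_mem hu hxu] with y hy i hi
  exact hfin.mem_toFinset.2 ⟨_, T.mem_of_lam_ne_zero hi, hut hy⟩

include hπ in
theorem smoothAt_transition {q : Plot Q m} {x : Euc m} {i : ι} (hx : π (q.1 x) ∈ T.U i) :
    SmoothAt (fun y => transition H (T.sec i (π (q.1 y))) (q.1 y)) x := by
  have hU : {y | π (q.1 y) ∈ T.U i} ∈ 𝓝 x :=
    ((hπ.smooth_proj_comp q).smoothAt x).eventually_mem (T.isOpen_U i) hx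
  obtain ⟨ρ, hρ, hρx, hρU⟩ := exists_contDiff_eventuallyEq_id hU
  have hsec : IsPlot fun y => T.sec i (π (q.1 (ρ y))) :=
    T.smooth_sec i m _ (isPlot_reparam (hπ.smooth_proj m q.1 q.2) hρ) hρU
  have hsmul : (fun y => op (transition H (T.sec i (π (q.1 (ρ y)))) (q.1 (ρ y))) •
      T.sec i (π (q.1 (ρ y)))) = q.1 ∘ ρ :=
    funext fun y => (hπ.transition_spec (T.proj_sec i _ (hρU y))).symm
  refine ⟨_, smooth_iff_isPlot.2 (hπ.smooth_div hsec (hsmul ▸ isPlot_reparam q.2 hρ)), ?_⟩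
  filter_upwards [hρx] with y hy
  rw [hy, id]

/-- The contribution `λ_i h_i⁻¹dh_i` of the `i`-th local section to the barycentric connection
form, where `h_i` is defined on `π⁻¹(U_i)` by `q = s_i(π(q)) h_i(q)`. -/
noncomputable def barycentricTerm : E :=
  T.lam i (π (q.1 x)) • φ.logDeriv (fun y => transition H (T.sec i (π (q.1 y))) (q.1 y)) x v

variable {φ q x i} in
theorem barycentricTerm_eq_zero (h : T.lam i (π (q.1 x)) = 0) :
    T.barycentricTerm φ q x v i = 0 := by
  rw [barycentricTerm, h, zero_smul]

variable {q x} in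
theorem finsum_barycentricTerm {s : Finset ι} (hs : ∀ i, T.lam i (π (q.1 x)) ≠ 0 → i ∈ s) :
    ∑ᶠ i, T.barycentricTerm φ q x v i = ∑ i ∈ s, T.barycentricTerm φ q x v i :=
  finsum_eq_sum_of_support_subset _ fun i hi =>
    hs i fun h => hi (T.barycentricTerm_eq_zero v h)

variable [DiffeologicalGroup H] [ConvenientSpace E]

include hπ

theorem isLinearMap_barycentricTerm : IsLinearMap ℝ fun v => T.barycentricTerm φ q x v i := by
  by_cases hlam : T.lam i (π (q.1 x)) = 0
  · simp only [T.barycentricTerm_eq_zero _ hlam]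
    exact (0 : Euc m →ₗ[ℝ] E).isLinear
  · have htrans := T.smoothAt_transition hπ (T.mem_of_lam_ne_zero hlam)
    exact ⟨fun v w => by simp only [barycentricTerm, φ.logDeriv_add htrans, smul_add],
      fun c v => by simp only [barycentricTerm, φ.logDeriv_smul htrans, smul_comm c]⟩

theorem smoothAt_barycentricTerm : SmoothAt (fun y => T.barycentricTerm φ q y v i) x := by
  have hproj := (hπ.smooth_proj_comp q).smoothAt x
  by_cases hx : π (q.1 x) ∈ T.U i
  · exact (hproj.dSmooth_comp (T.smooth_lam i)).smul
      (φ.smoothAt_logDeriv (T.smoothAt_transition hπ hx) v)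
  · have hopen : IsOpen[dTopology] (@closure X dTopology (Function.support (T.lam i)))ᶜ :=
      (@isClosed_closure X dTopology _).isOpen_compl
    refine (smoothAt_const (0 : E) x).congr ?_
    filter_upwards [hproj.eventually_mem hopen fun h => hx (T.lam_supp i h)] with y hy
    exact (T.barycentricTerm_eq_zero v <| Function.notMem_support.1 fun h =>
      hy (@subset_closure X dTopology _ _ h)).symm

theorem barycentricTerm_comp {k : ℕ} {f : Euc k → Euc m} (hf : ContDiff ℝ ∞ f) (x v : Euc k) :
    T.barycentricTerm φ ⟨q.1 ∘ f, isPlot_reparam q.2 hf⟩ x v i =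
      T.barycentricTerm φ q (f x) (fderiv ℝ f x v) i := by
  by_cases hlam : T.lam i (π (q.1 (f x))) = 0
  · exact (T.barycentricTerm_eq_zero v hlam).trans (T.barycentricTerm_eq_zero _ hlam).symm
  · exact congrArg _ (φ.logDeriv_comp (T.smoothAt_transition hπ (T.mem_of_lam_ne_zero hlam)) hf v)

theorem barycentricTerm_gauge {h : Euc m → H} (hh : IsPlot h)
    (hq : IsPlot fun y => op (h y) • q.1 y) :
    T.barycentricTerm φ ⟨fun y => op (h y) • q.1 y, hq⟩ x v i =
      φ.Ad (h x)⁻¹ (T.barycentricTerm φ q x v i) +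
        T.lam i (π (q.1 x)) • φ.logDeriv h x v := by
  simp only [barycentricTerm, hπ.proj_smul]
  by_cases hlam : T.lam i (π (q.1 x)) = 0
  · simpa [hlam] using (φ.Ad_smul (h x)⁻¹ 0 0).symm
  · have hx := T.mem_of_lam_ne_zero hlam
    have htrans : (fun y => transition H (T.sec i (π (q.1 y))) (op (h y) • q.1 y)) =ᶠ[𝓝 x]
        fun y => transition H (T.sec i (π (q.1 y))) (q.1 y) * h y :=
      (((hπ.smooth_proj_comp q).smoothAt x).eventually_mem (T.isOpen_U i) hx).mono
        fun y hy => hπ.transition_smul (T.proj_sec i _ hy) (h y)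
    rw [φ.logDeriv_congr htrans, φ.logDeriv_mul (T.smoothAt_transition hπ hx)
      ((smooth_iff_isPlot.2 hh).smoothAt x), smul_add, φ.Ad_smul]

/-- The barycentric connection `∑ i, λ_i h_i⁻¹dh_i`: the average of the flat connections which the
local sections define over the sets `U_i`, with the partition of unity as weights. -/
noncomputable def barycentricConnection : Connection φ Q where
  form _ q x v := ∑ᶠ i, T.barycentricTerm φ q x v i
  linear m q x := by
    obtain ⟨s, hs⟩ := T.exists_finset_eventually_lam_ne_zero hπ q x
    have hlin (i : ι) := T.isLinearMap_barycentricTerm hπ φ q x i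
    simp only [T.finsum_barycentricTerm φ _ hs.self_of_nhds]
    exact ⟨fun v w => by simp only [(hlin _).map_add, Finset.sum_add_distrib],
      fun c v => by simp only [(hlin _).map_smul, Finset.smul_sum]⟩
  smooth m q v := by
    refine smooth_iff_isPlot.1 (smooth_of_forall_smoothAt fun x => ?_)
    obtain ⟨s, hs⟩ := T.exists_finset_eventually_lam_ne_zero hπ q x
    refine (SmoothAt.sum s fun i _ => T.smoothAt_barycentricTerm hπ φ q x v i).congr ?_
    exact hs.mono fun y hy => (T.finsum_barycentricTerm φ v hy).symm
  pullback m k q f hf x v := finsum_congr fun i => T.barycentricTerm_comp hπ φ q i hf x v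
  gauge m q h hh hq x v := by
    obtain ⟨s, hs⟩ := T.exists_finset_eventually_lam_ne_zero hπ q x
    have hsx := hs.self_of_nhds
    rw [T.finsum_barycentricTerm φ v hsx,
      T.finsum_barycentricTerm φ v (s := s) (by simpa only [hπ.proj_smul] using hsx)]
    simp only [T.barycentricTerm_gauge hπ φ q x v _ hh hq, Finset.sum_add_distrib,
      ← Finset.sum_smul, T.sum_lam_eq_one hsx, one_smul]
    congr 1
    exact (map_sum (φ.adLinearMap (h x)⁻¹) _ s).symm

theorem localForm_barycentricConnection (k : ι) {p : Euc m → X} (hp : IsPlot p)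
    (hU : ∀ x, p x ∈ T.U k) :
    (T.barycentricConnection hπ φ).localForm T.toLocalSections k p hp hU =
      baryForm φ T k p := by
  funext x v
  have hproj (y : Euc m) : π (T.sec k (p y)) = p y := T.proj_sec k _ (hU y)
  simp only [Connection.localForm, barycentricConnection, barycentricTerm, Function.comp_apply,
    hproj, baryForm]

theorem gluesBary_iff {r : ℕ} (P : MultilinearMap ℝ (fun _ : Fin r => E) ℝ)
    (η : DForm X (2 * r)) : GluesBary φ P T η ↔
      GluesConnection φ P T.toLocalSections (T.barycentricConnection hπ φ) η := by
  refine forall₄_congr fun k m p hp => forall_congr' fun hU => ?_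
  rw [T.localForm_barycentricConnection hπ φ k hp hU]

end NumerableSections

end Barycentric

section DeRhamClass

variable {X Q H E : Type*} [DiffeologicalSpace X] [DiffeologicalSpace Q]
  [Group H] [DiffeologicalSpace H] [DiffeologicalGroup H] [MulAction Hᵐᵒᵖ Q]
  [AddCommGroup E] [Module ℝ E] [DiffeologicalSpace E] [ConvenientSpace E]
  {φ : LieChart H E} {π : Q → X} (hπ : IsPrincipalBundle H π)
  {r : ℕ} {P : MultilinearMap ℝ (fun _ : Fin r => E) ℝ} (hP : φ.IsInvariantPolynomial P)

/-- The Chern–Weil form of a connection, as an element of the space of closed forms. -/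
noncomputable def Connection.closedChernWeil (Θ : Connection φ Q) : closedForms X (2 * r) :=
  ⟨Θ.chernWeil hπ hP, LinearMap.mem_ker.2 (Θ.extD_chernWeil hπ hP)⟩

theorem Connection.deRhamClass_closedChernWeil_eq (Θ₀ Θ₁ : Connection φ Q) :
    deRhamClass (Θ₁.closedChernWeil hπ hP) = deRhamClass (Θ₀.closedChernWeil hπ hP) :=
  (Submodule.Quotient.eq _).2 (Θ₀.chernWeil_sub_mem_exactForms Θ₁ hπ hP)

theorem exists_deRhamClass_closedChernWeil_eq : ∃ c : DeRham X (2 * r), ∀ Θ : Connection φ Q,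
    deRhamClass (Θ.closedChernWeil hπ hP) = c := by
  rcases isEmpty_or_nonempty (Connection φ Q) with _ | ⟨⟨Θ₀⟩⟩
  · exact ⟨0, isEmptyElim⟩
  · exact ⟨_, Θ₀.deRhamClass_closedChernWeil_eq hπ hP⟩

end DeRhamClass

section Semidirect

variable {G : Type*} [Group G] [DiffeologicalSpace G] (σ : ℤˣ →* MulAut G)

variable {σ} in
theorem isPlot_act_of_isLocallyConstant (hσ : ∀ ε, DSmooth (σ ε)) {m : ℕ} {p : Euc m → G}
    {ε : Euc m → ℤˣ} (hp : IsPlot p) (hε : IsLocallyConstant ε) :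
    IsPlot fun x => σ (ε x) (p x) := by
  refine smooth_iff_isPlot.1 (smooth_of_forall_smoothAt fun x => ?_)
  refine (((smooth_iff_isPlot.2 hp).smoothAt x).dSmooth_comp (hσ (ε x))).congr ?_
  filter_upwards [(IsLocallyConstant.iff_eventually_eq ε).1 hε x] with y hy
  rw [hy]

theorem diffeologicalGroup_semidirect [DiffeologicalGroup G] (hσ : ∀ ε, DSmooth (σ ε)) :
    DiffeologicalGroup (G ⋊[σ] ℤˣ) where
  mul_plot hp hq := ⟨DiffeologicalGroup.mul_plot hp.1
    (isPlot_act_of_isLocallyConstant hσ hq.1 hp.2), hp.2.mul hq.2⟩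
  inv_plot hp := ⟨isPlot_act_of_isLocallyConstant hσ (DiffeologicalGroup.inv_plot hp.1) hp.2.inv,
    hp.2.inv⟩

end Semidirect

end BaryChernWeil

theorem mainTheorem10_general
    {X Q H E : Type*} [DiffeologicalSpace X] [DiffeologicalSpace Q]
    [Group H] [DiffeologicalSpace H] [BaryChernWeil.DiffeologicalGroup H] [MulAction Hᵐᵒᵖ Q]
    [AddCommGroup E] [Module ℝ E] [DiffeologicalSpace E] [BaryChernWeil.ConvenientSpace E]
    (φ : BaryChernWeil.LieChart H E)
    (π : Q → X) (hπ : BaryChernWeil.IsPrincipalBundle H π)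
    {r : ℕ} (P : MultilinearMap ℝ (fun _ : Fin r => E) ℝ)
    (hP : φ.IsInvariantPolynomial P) :
    (∀ (ι : Type*) (T : BaryChernWeil.NumerableSections π ι),
      ∃ Θ : BaryChernWeil.Connection φ Q,
        ∀ (k : ι) (m : ℕ) (p : BaryChernWeil.Euc m → X) (hp : Diffeology.IsPlot p)
          (hU : ∀ x, p x ∈ T.U k),
          Θ.localForm T.toLocalSections k p hp hU =
            BaryChernWeil.baryForm φ T k p) ∧
    ∃ c : BaryChernWeil.DeRham X (2 * r),
      (∀ (ι : Type*) (T : BaryChernWeil.NumerableSections π ι),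
        ∃ η : BaryChernWeil.closedForms X (2 * r),
          BaryChernWeil.GluesBary φ P T η.1 ∧
          (∀ η' : BaryChernWeil.DForm X (2 * r),
            BaryChernWeil.GluesBary φ P T η' → η' = η.1) ∧
          BaryChernWeil.deRhamClass η = c) ∧
      (∀ (Θ : BaryChernWeil.Connection φ Q)
        (ι : Type*) (S : BaryChernWeil.LocalSections π ι),
        ∃ η : BaryChernWeil.closedForms X (2 * r),
          BaryChernWeil.GluesConnection φ P S Θ η.1 ∧
          (∀ η' : BaryChernWeil.DForm X (2 * r),
            BaryChernWeil.GluesConnection φ P S Θ η' → η' = η.1) ∧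
          BaryChernWeil.deRhamClass η = c) := by
  obtain ⟨c, hc⟩ := BaryChernWeil.exists_deRhamClass_closedChernWeil_eq hπ hP
  refine ⟨fun ι T => ⟨T.barycentricConnection hπ φ,
    fun k m p hp hU => T.localForm_barycentricConnection hπ φ k hp hU⟩,
    c, fun ι T => ?barycentric, fun Θ ι S => ?connection⟩
  case barycentric =>
    let Θ := T.barycentricConnection hπ φ
    have hglues := Θ.gluesConnection_chernWeil hπ hP T.toLocalSections
    exact ⟨Θ.closedChernWeil hπ hP, (T.gluesBary_iff hπ φ P _).2 hglues,
      fun η' hη' => ((T.gluesBary_iff hπ φ P η').1 hη').unique hglues, hc Θ⟩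
  case connection =>
    have hglues := Θ.gluesConnection_chernWeil hπ hP S
    exact ⟨Θ.closedChernWeil hπ hP, hglues, fun η' hη' => hη'.unique hglues, hc Θ⟩

theorem mainTheorem10
    {X Q G E : Type*} [DiffeologicalSpace X] [DiffeologicalSpace Q]
    [Group G] [DiffeologicalSpace G] [BaryChernWeil.DiffeologicalGroup G]
    [AddCommGroup E] [Module ℝ E] [DiffeologicalSpace E] [BaryChernWeil.ConvenientSpace E]
    (φ : BaryChernWeil.LieChart G E)
    (σ : ℤˣ →* MulAut G) (hσ : ∀ ε, Diffeology.DSmooth (σ ε))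
    [MulAction (G ⋊[σ] ℤˣ)ᵐᵒᵖ Q]
    (π : Q → X) (hπ : BaryChernWeil.IsPrincipalBundle (G ⋊[σ] ℤˣ) π)
    {r : ℕ} (P : MultilinearMap ℝ (fun _ : Fin r => E) ℝ)
    (hP : (φ.semidirect σ).IsInvariantPolynomial P) :
    -- the barycentric local forms are the local forms of a connection
    (∀ (ι : Type*) (T : BaryChernWeil.NumerableSections π ι),
      ∃ Θ : BaryChernWeil.Connection (φ.semidirect σ) Q,
        ∀ (k : ι) (m : ℕ) (p : BaryChernWeil.Euc m → X) (hp : Diffeology.IsPlot p)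
          (hU : ∀ x, p x ∈ T.U k),
          Θ.localForm T.toLocalSections k p hp hU =
            BaryChernWeil.baryForm (φ.semidirect σ) T k p) ∧
    -- one and the same de Rham class is obtained from all choices
    ∃ c : BaryChernWeil.DeRham X (2 * r),
      (∀ (ι : Type*) (T : BaryChernWeil.NumerableSections π ι),
        ∃ η : BaryChernWeil.closedForms X (2 * r),
          BaryChernWeil.GluesBary (φ.semidirect σ) P T η.1 ∧
          (∀ η' : BaryChernWeil.DForm X (2 * r),
            BaryChernWeil.GluesBary (φ.semidirect σ) P T η' → η' = η.1) ∧
          BaryChernWeil.deRhamClass η = c) ∧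
      (∀ (Θ : BaryChernWeil.Connection (φ.semidirect σ) Q)
        (ι : Type*) (S : BaryChernWeil.LocalSections π ι),
        ∃ η : BaryChernWeil.closedForms X (2 * r),
          BaryChernWeil.GluesConnection (φ.semidirect σ) P S Θ η.1 ∧
          (∀ η' : BaryChernWeil.DForm X (2 * r),
            BaryChernWeil.GluesConnection (φ.semidirect σ) P S Θ η' → η' = η.1) ∧
          BaryChernWeil.deRhamClass η = c) :=
  have := BaryChernWeil.diffeologicalGroup_semidirect σ hσ
  mainTheorem10_general (φ.semidirect σ) π hπ P hP
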